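/- **Language.** Value expressions over a context of real variables are $s ::= x \mid s+s \mid \alpha\cdot s \mid \underline\beta$ ($\alpha,\beta\in\mathbb R$), taken modulo the theory of pointed vector spaces: the vector space axioms together with $\alpha\cdot\underline\beta=\underline{\alpha\beta}$ and $\underline\alpha+\underline\beta=\underline{\alpha+\beta}$. Computations of type $R^m$ are $t ::= \nu x.t \mid (s =:= s');t \mid \mathrm r[s_1,\dots,s_m] \mid \bot$: sample a standard normal variable $x$ and continue, condition on an exact equality and continue, return, fail. Derivable equality $\equiv$ is the least congruence on computations that respects equality of value expressions, is closed under substitution of value expressions for variables and of computations for $\mathrm r$ (that is, $t[u/\mathrm r]$, which replaces the return statements of $t$ by $u$), and contains - (DISC) $\nu x.\mathrm r[]\equiv \mathrm r[]$; (ORTH) $\nu\vec x.\mathrm r[U\vec x]\equiv\nu\vec x.\mathrm r[\vec x]$ for $U$ orthogonal; - (C1) $(a=:=b)(c=:=d)\mathrm r[]\equiv(c=:=d)(a=:=b)\mathrm r[]$; (C2) $(a=:=b);\nu x.\mathrm r[x]\equiv\nu x.(a=:=b)\mathrm r[x]$ with $x$ fresh; (C3) $(a=:=b)\bot\equiv\bot$;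 - (TAUT) $(a=:=a)\mathrm r[]\equiv\mathrm r[]$; (FAIL) $(\underline0=:=\underline1)\mathrm r[]\equiv\bot$; (SUBS) $(a=:=b)\mathrm r[a]\equiv(a=:=b)\mathrm r[b]$; (INIT) $\nu x.(x=:=\underline c)\mathrm r[x]\equiv\mathrm r[\underline c]$; - (CONG) $(s=:=t)\mathrm r[]\equiv(s'=:=t')\mathrm r[]$ whenever the equations $s=t$ and $s'=t'$ over a fixed context are interderivable in the theory of pointed vector spaces. **Denotation.** $\mathrm{Gauss}$ is the Markov category with objects $\mathbb R^n$ and morphisms $f(x)=Ax+b+\mathcal N(\Sigma)$, $\Sigma$ positive semidefinite. Morphisms $X\rightsquigarrow Y$ of $\mathrm{Cond}(\mathrm{Gauss})$ are represented by triples $(K,f,o)$, where $f:X\to Y\otimes K$ and $o$ is a deterministic state of $K$. The state $(\mathrm{id}_W\otimes f)\psi$ that $(K,f,o)$ and a Gaussian state $\psi$ on $W\otimes X$ determine *succeeds* if $o\ll\psi_K$, where $\psi_K$ denotes its marginal on $K$; it then has a posterior, the value at $o$ of its conditional distribution given $K$. Two triples represent the same morphism if, for all $W$ and $\psi$, either both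 fail, or both succeed with equal posteriors. Here $\mu\ll\nu$ means that morphisms that are $\nu$-almost surely equal are $\mu$-almost surely equal. A term $\vec x:R^n\vdash t:R^m$ denotes a morphism $[\![t]\!]:n\rightsquigarrow m$, where $s=:=t$ observes the value $0$ of $s-t$, and $\bot$ is a conditioning problem that always fails. **Theorem (Normal forms).** Every term $\vec x:R^n\vdash u:R^0$ is derivably equal either to $\bot$ or to a soft constraint $$\nu\vec z.\,(A\vec x =:= B\vec z+\vec c);\mathrm r[]$$ with $A\in\mathbb R^{r\times n}$ in reduced row echelon form with no zero rows, $B\in\mathbb R^{r\times k}$ and $\vec c\in\mathbb R^r$ for some $r,k\ge 0$. The two cases exclude each other, and $A$, $\vec c$ and $BB^T$ (and $r$) are uniquely determined: if $u$ is derivably equal to two such soft constraints, given by $(A,B,\vec c)$ and $(A',B',\vec c')$, then $A=A'$, $\vec c=\vec c'$ and $BB^T=B'B'^T$. The same holds at the level of denotations: two such soft constraints with the same denotation in $\mathrm{Cond}(\mathrm{Gauss})$ have the same $A$, $\vec c$ and $BB^T$, and no such soft constraint has the same denotation as $\bot$. -/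

import Mathlib

open scoped Matrix

namespace ExactCond

/-! ## Value expressions: affine algebra -/

/-- Expressions of type `R` in a context of `n` real variables. -/
inductive Aff (n : ℕ) : Type
  | var : Fin n → Aff n
  | add : Aff n → Aff n → Aff n
  | smul : ℝ → Aff n → Aff n
  | const : ℝ → Aff n

namespace Aff

/-- Simultaneous substitution of value expressions for variables. -/
def subst {n n' : ℕ} (σ : Fin n → Aff n') : Aff n → Aff n'
  | var i => σ i
  | add s t => add (subst σ s) (subst σ t)
  | smul α t => smul α (subst σ t)
  | const β => const β

/-- Extension of a substitution under a binder; the bound variable is the last one. -/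
def lift {n n' : ℕ} (σ : Fin n → Aff n') : Fin (n + 1) → Aff (n' + 1) :=
  Fin.snoc (fun i => (σ i).subst fun j => var j.castSucc) (var (Fin.last n'))

/-- The expression `t₀ + ⋯ + tₖ₋₁`. -/
def sum {n : ℕ} : (k : ℕ) → (Fin k → Aff n) → Aff n
  | 0, _ => const 0
  | k + 1, t => add (sum k fun i => t i.castSucc) (t (Fin.last k))

/-- The `i`-th entry of the matrix-vector product `M v`, for a vector `v` of variables. -/
def row {n r k : ℕ} (M : Matrix (Fin r) (Fin k) ℝ) (v : Fin k → Fin n) (i : Fin r) : Aff n :=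
  sum k fun j => smul (M i j) (var (v j))

end Aff

/-- Derivability of equations between value expressions over a fixed context, in the theory of
pointed vector spaces (vector spaces over `ℝ` with constants `β`), from the equations in `H`.
The variables of the context are treated as constants. -/
inductive AffDer {n : ℕ} (H : Aff n → Aff n → Prop) : Aff n → Aff n → Prop
  | hyp {s t} : H s t → AffDer H s t
  | refl (s) : AffDer H s s
  | symm {s t} : AffDer H s t → AffDer H t s
  | trans {s t u} : AffDer H s t → AffDer H t u → AffDer H s u
  | congr_add {s s' t t'} :
      AffDer H s s' → AffDer H t t' → AffDer H (.add s t) (.add s' t')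
  | congr_smul (α : ℝ) {s s'} : AffDer H s s' → AffDer H (.smul α s) (.smul α s')
  | add_assoc (s t u) : AffDer H (.add (.add s t) u) (.add s (.add t u))
  | add_comm (s t) : AffDer H (.add s t) (.add t s)
  | add_zero (s) : AffDer H (.add s (.const 0)) s
  | zero_smul (s) : AffDer H (.smul 0 s) (.const 0)
  | one_smul (s) : AffDer H (.smul 1 s) s
  | mul_smul (α β : ℝ) (s) : AffDer H (.smul (α * β) s) (.smul α (.smul β s))
  | add_smul (α β : ℝ) (s) : AffDer H (.smul (α + β) s) (.add (.smul α s) (.smul β s))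
  | smul_add (α : ℝ) (s t) : AffDer H (.smul α (.add s t)) (.add (.smul α s) (.smul α t))
  | smul_const (α β : ℝ) : AffDer H (.smul α (.const β)) (.const (α * β))
  | add_const (α β : ℝ) : AffDer H (.add (.const α) (.const β)) (.const (α + β))

/-- Equality of value expressions: derivability without hypotheses. -/
def AffEq {n : ℕ} (s t : Aff n) : Prop := AffDer (fun _ _ => False) s t

/-- The equations `s = t` and `s' = t'` are interderivable over their context. -/
def Interderivable {n : ℕ} (s t s' t' : Aff n) : Prop :=
  AffDer (fun a b => a = s ∧ b = t) s' t' ∧ AffDer (fun a b => a = s' ∧ b = t') s t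

/-! ## Computations -/

/-- Computations of type `R^m` in a context of `n` real variables. -/
inductive Tm : ℕ → ℕ → Type
  /-- `let x = normal() in t`; the bound variable is the last one in the context of `t` -/
  | nu {n m : ℕ} : Tm (n + 1) m → Tm n m
  /-- `(s =:= t); u` -/
  | cond {n m : ℕ} : Aff n → Aff n → Tm n m → Tm n m
  /-- `return(t₁, …, tₘ)` -/
  | ret {n m : ℕ} : (Fin m → Aff n) → Tm n m
  /-- failure -/
  | bot {n m : ℕ} : Tm n m

namespace Tm

/-- Simultaneous substitution of value expressions for variables. -/
def subst : {n n' m : ℕ} → (Fin n → Aff n') → Tm n m → Tm n' m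
  | _, _, _, σ, nu t => nu (subst (Aff.lift σ) t)
  | _, _, _, σ, cond s t u => cond (s.subst σ) (t.subst σ) (subst σ u)
  | _, _, _, σ, ret t => ret fun i => (t i).subst σ
  | _, _, _, _, bot => bot

/-- `t[u/return]`, where `u` lives in the context of `t` extended by the `m` returned values. -/
def bind : {n m l : ℕ} → Tm n m → Tm (n + m) l → Tm n l
  | n, m, _, nu t, u =>
      nu (bind t (u.subst (Fin.append (fun i : Fin n => Aff.var (Fin.castAdd m i.castSucc))
        (fun j : Fin m => Aff.var (Fin.natAdd (n + 1) j)))))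
  | _, _, _, cond s t v, u => cond s t (bind v u)
  | _, _, _, ret t, u => u.subst (Fin.append Aff.var t)
  | _, _, _, bot, _ => bot

/-- `ν z₁. … ν zₖ. t`; the bound variables are the last `k` ones in the context of `t`. -/
def nus {n m : ℕ} : (k : ℕ) → Tm (n + k) m → Tm n m
  | 0, t => t
  | k + 1, t => nus k (nu t)

/-- `(s₁ =:= t₁); …; (sᵣ =:= tᵣ); u`. -/
def conds {n m : ℕ} : (r : ℕ) → (Fin r → Aff n) → (Fin r → Aff n) → Tm n m → Tm n m
  | 0, _, _, u => u
  | r + 1, s, t, u => cond (s 0) (t 0) (conds r (fun i => s i.succ) (fun i => t i.succ) u)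

/-- `return()`, of unit type. -/
def done {n : ℕ} : Tm n 0 := ret Fin.elim0

/-- The soft constraint `ν z. (A x =:= B z + c); return()` in the context `x`. -/
def soft {n r k : ℕ} (A : Matrix (Fin r) (Fin n) ℝ) (B : Matrix (Fin r) (Fin k) ℝ)
    (c : Fin r → ℝ) : Tm n 0 :=
  nus k (conds r (Aff.row A (Fin.castAdd k))
    (fun i => .add (Aff.row B (Fin.natAdd n) i) (.const (c i))) done)

end Tm

open Tm in
/-- Derivable equality of computations. -/
inductive Der : {n m : ℕ} → Tm n m → Tm n m → Prop
  -- equivalence relation and congruence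
  | refl {n m} (t : Tm n m) : Der t t
  | symm {n m} {t u : Tm n m} : Der t u → Der u t
  | trans {n m} {t u v : Tm n m} : Der t u → Der u v → Der t v
  | congr_nu {n m} {t t' : Tm (n + 1) m} : Der t t' → Der (nu t) (nu t')
  | congr_cond {n m} {s s' t t' : Aff n} {u u' : Tm n m} :
      AffEq s s' → AffEq t t' → Der u u' → Der (cond s t u) (cond s' t' u')
  | congr_ret {n m} {t t' : Fin m → Aff n} :
      (∀ i, AffEq (t i) (t' i)) → Der (ret t) (ret t')
  -- closure under the two forms of substitution
  | subst {n n' m} (σ : Fin n → Aff n') {t t' : Tm n m} :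
      Der t t' → Der (t.subst σ) (t'.subst σ)
  | bind {n m l} {t t' : Tm n m} {u u' : Tm (n + m) l} :
      Der t t' → Der u u' → Der (t.bind u) (t'.bind u')
  -- the axioms
  | disc {n} : Der (nu done : Tm n 0) done
  | orth {n k} (U : Matrix (Fin k) (Fin k) ℝ) : U ∈ Matrix.orthogonalGroup (Fin k) ℝ →
      Der (nus k (ret (Aff.row U (Fin.natAdd n))))
        (nus k (ret fun i => .var (Fin.natAdd n i)))
  | cond_comm {n} (a b c d : Aff n) :
      Der (cond a b (cond c d done)) (cond c d (cond a b done))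
  | nu_comm_cond {n} (a b : Aff n) :
      Der (cond a b (nu (ret fun _ : Fin 1 => .var (Fin.last n))))
        (nu (cond (a.subst fun i => .var i.castSucc) (b.subst fun i => .var i.castSucc)
          (ret fun _ : Fin 1 => .var (Fin.last n))))
  | cond_bot {n m} (a b : Aff n) : Der (cond a b (bot : Tm n m)) bot
  | taut {n} (a : Aff n) : Der (cond a a done) done
  | fail {n} : Der (cond (.const 0) (.const 1) (done : Tm n 0)) bot
  | subs {n} (a b : Aff n) :
      Der (cond a b (ret fun _ : Fin 1 => a)) (cond a b (ret fun _ : Fin 1 => b))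
  | init {n} (c : ℝ) :
      Der (nu (cond (.var (Fin.last n)) (.const c) (ret fun _ : Fin 1 => .var (Fin.last n))))
        (ret fun _ : Fin 1 => .const c)
  | cong {n} {s t s' t' : Aff n} : Interderivable s t s' t' →
      Der (cond s t done) (cond s' t' done)

/-! ## Reduced row echelon form -/

/-- `A i j` is the leading entry of row `i`. -/
def IsLeading {r n : ℕ} (A : Matrix (Fin r) (Fin n) ℝ) (i : Fin r) (j : Fin n) : Prop :=
  A i j ≠ 0 ∧ ∀ j' < j, A i j' = 0

/-- Reduced row echelon form. -/
structure IsRREF {r n : ℕ} (A : Matrix (Fin r) (Fin n) ℝ) : Prop where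
  zero_rows_last : ∀ i i', i < i' → A i = 0 → A i' = 0
  staircase : ∀ i i' j j', i < i' → IsLeading A i j → IsLeading A i' j' → j < j'
  leading_one : ∀ i j, IsLeading A i j → A i j = 1
  leading_column : ∀ i j, IsLeading A i j → ∀ i', i' ≠ i → A i' j = 0

/-! ## The category `Gauss`

Objects are finite index types `X`, standing for the space `ℝ^X`, with `⊕` as tensor product. -/

/-- A morphism `x ↦ A x + b + N(0, S)` of `Gauss`. -/
@[ext]
structure GaussHom (X Y : Type) [Fintype X] [Fintype Y] where
  A : Matrix Y X ℝ
  b : Y → ℝ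
  S : Matrix Y Y ℝ
  posSemidef : S.PosSemidef

namespace GaussHom

variable {X Y Z W : Type} [Fintype X] [Fintype Y] [Fintype Z] [Fintype W]

/-- Sequential composition, `g` after `f`. -/
def comp (g : GaussHom Y Z) (f : GaussHom X Y) : GaussHom X Z where
  A := g.A * f.A
  b := g.A *ᵥ f.b + g.b
  S := g.A * f.S * g.Aᵀ + g.S
  posSemidef := by
    have h := f.posSemidef.mul_mul_conjTranspose_same g.A
    rw [Matrix.conjTranspose_eq_transpose_of_trivial] at h
    exact h.add g.posSemidef

/-- The deterministic morphism `x ↦ A x + b`. -/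
def det (A : Matrix Y X ℝ) (b : Y → ℝ) : GaussHom X Y := ⟨A, b, 0, Matrix.PosSemidef.zero⟩

/-- Parallel composition. -/
def tensor (f : GaussHom X Y) (g : GaussHom Z W) : GaussHom (X ⊕ Z) (Y ⊕ W) where
  A := Matrix.fromBlocks f.A 0 0 g.A
  b := Sum.elim f.b g.b
  S := Matrix.fromBlocks f.S 0 0 g.S
  posSemidef := by
    classical
    have h1 := f.posSemidef.mul_mul_conjTranspose_same
      (Matrix.fromRows (1 : Matrix Y Y ℝ) (0 : Matrix W Y ℝ))
    have h2 := g.posSemidef.mul_mul_conjTranspose_same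
      (Matrix.fromRows (0 : Matrix Y W ℝ) (1 : Matrix W W ℝ))
    have h := h1.add h2
    convert h using 1
    ext (i | i) (j | j) <;>
      simp [Matrix.conjTranspose_eq_transpose_of_trivial, Matrix.transpose_fromRows,
        Matrix.fromRows_mul, Matrix.mul_fromCols]

/-- The deterministic morphism `x ↦ x ∘ e`, which copies, deletes and permutes coordinates. -/
def wire [DecidableEq X] (e : Y → X) : GaussHom X Y :=
  det ((1 : Matrix X X ℝ).submatrix e id) 0

/-- The tupling of `f` and `g`: copy the input, then apply `f` and `g` in parallel. -/
def pair [DecidableEq X] (f : GaussHom X Y) (g : GaussHom X Z) : GaussHom X (Y ⊕ Z) :=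
  (tensor f g).comp (wire (Sum.elim id id))

/-- The standard normal distribution, with the input deleted. -/
def normal : GaussHom X Unit := ⟨0, 0, 1, Matrix.PosSemidef.one⟩

/-- Almost sure equality of `f` and `g` with respect to the state `μ`. -/
def AsEq [DecidableEq X] (μ : GaussHom (Fin 0) X) (f g : GaussHom X Y) : Prop :=
  (pair (wire id) f).comp μ = (pair (wire id) g).comp μ

/-- Absolute continuity `μ ≪ ν` of states. -/
def AbsCont [DecidableEq X] (μ ν : GaussHom (Fin 0) X) : Prop :=
  ∀ (m : ℕ) (f g : GaussHom X (Fin m)), AsEq ν f g → AsEq μ f g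

/-- The marginal of `ψ` on the second factor. -/
def marg [DecidableEq X] [DecidableEq Y] (ψ : GaussHom (Fin 0) (X ⊕ Y)) : GaussHom (Fin 0) Y :=
  (wire Sum.inr).comp ψ

/-- `κ` is a conditional distribution of `ψ` given the second factor. -/
def IsConditional [DecidableEq X] [DecidableEq Y] (ψ : GaussHom (Fin 0) (X ⊕ Y))
    (κ : GaussHom Y X) : Prop :=
  (pair κ (wire id)).comp (marg ψ) = ψ

end GaussHom

/-! ## The category `Cond(Gauss)` -/

/-- A morphism of `Obs(Gauss)`: a morphism `f : X → Y ⊗ K` with a deterministic observation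
`o` of the hidden output `K`. -/
structure ObsHom (X Y : Type) [Fintype X] [Fintype Y] where
  K : Type
  fin : Fintype K
  dec : DecidableEq K
  f : GaussHom X (Y ⊕ K)
  o : K → ℝ

attribute [instance] ObsHom.fin ObsHom.dec

namespace ObsHom

variable {X Y : Type} [Fintype X] [Fintype Y]

/-- The observation as a deterministic state. -/
def obs (φ : ObsHom X Y) : GaussHom (Fin 0) φ.K := GaussHom.det 0 φ.o

/-- The observation lies in the support of the model. -/
def Succeeds [DecidableEq Y] (φ : ObsHom (Fin 0) Y) : Prop :=
  GaussHom.AbsCont φ.obs (GaussHom.marg φ.f)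

/-- Equivalence of states: both conditioning problems fail, or both succeed with equal
posteriors. -/
def StateEquiv [DecidableEq Y] (φ φ' : ObsHom (Fin 0) Y) : Prop :=
  (φ.Succeeds ∧ φ'.Succeeds ∧
    ∃ (κ : GaussHom φ.K Y) (κ' : GaussHom φ'.K Y), GaussHom.IsConditional φ.f κ ∧
      GaussHom.IsConditional φ'.f κ' ∧ κ.comp φ.obs = κ'.comp φ'.obs) ∨
  (¬ φ.Succeeds ∧ ¬ φ'.Succeeds)

/-- The state `(id_W ⊗ φ) ψ`, for a state `ψ` on `W ⊗ X`. -/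
def apply {W : Type} [Fintype W] [DecidableEq W] [DecidableEq Y] (φ : ObsHom X Y)
    (ψ : GaussHom (Fin 0) (W ⊕ X)) : ObsHom (Fin 0) (W ⊕ Y) where
  K := φ.K
  fin := φ.fin
  dec := φ.dec
  f := (GaussHom.wire (Equiv.sumAssoc W Y φ.K)).comp
    ((GaussHom.tensor (GaussHom.wire id) φ.f).comp ψ)
  o := φ.o

/-- Equality of the represented morphisms in `Cond(Gauss)`. -/
def CondEq [DecidableEq Y] (φ φ' : ObsHom X Y) : Prop :=
  ∀ (a : ℕ) (ψ : GaussHom (Fin 0) (Fin a ⊕ X)), StateEquiv (φ.apply ψ) (φ'.apply ψ)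

end ObsHom

/-! ## Denotation of terms in `Cond(Gauss)` -/

/-- The coefficients of the affine function denoted by a value expression. -/
def Aff.coeff {n : ℕ} : Aff n → Fin n → ℝ
  | .var i => Pi.single i 1
  | .add s t => s.coeff + t.coeff
  | .smul α t => α • t.coeff
  | .const _ => 0

/-- The constant part of the affine function denoted by a value expression. -/
def Aff.offset {n : ℕ} : Aff n → ℝ
  | .var _ => 0
  | .add s t => s.offset + t.offset
  | .smul α t => α * t.offset
  | .const β => β

/-- The deterministic morphism denoted by a tuple of value expressions. -/
def Aff.den {n : ℕ} {J : Type} [Fintype J] (t : J → Aff n) : GaussHom (Fin n) J :=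
  GaussHom.det (Matrix.of fun j i => (t j).coeff i) fun j => (t j).offset

/-- `x ↦ (x, z)` with `z` a fresh standard normal variable. -/
noncomputable def GaussHom.fresh (n : ℕ) : GaussHom (Fin n) (Fin (n + 1)) :=
  (GaussHom.wire (Fin.snoc Sum.inl (Sum.inr ()) : Fin (n + 1) → Fin n ⊕ Unit)).comp
    (GaussHom.pair (GaussHom.wire id) GaussHom.normal)

/-- The denotation of a term: `s =:= t` observes the value `0` of `s - t`, and failure observes
the value `0` of the constant `1`. -/
noncomputable def Tm.den : {n m : ℕ} → Tm n m → ObsHom (Fin n) (Fin m)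
  | n, _, .nu t =>
      { K := t.den.K
        fin := t.den.fin
        dec := t.den.dec
        f := t.den.f.comp (GaussHom.fresh n)
        o := t.den.o }
  | _, m, .cond s t u =>
      { K := u.den.K ⊕ Unit
        fin := inferInstance
        dec := inferInstance
        f := (GaussHom.wire (Equiv.sumAssoc (Fin m) u.den.K Unit).symm).comp
          (GaussHom.pair u.den.f (Aff.den fun _ : Unit => .add s (.smul (-1) t)))
        o := Sum.elim u.den.o fun _ => 0 }
  | _, m, .ret t =>
      { K := Fin 0
        fin := inferInstance
        dec := inferInstance
        f := (GaussHom.wire (Equiv.sumEmpty (Fin m) (Fin 0))).comp (Aff.den t)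
        o := Fin.elim0 }
  | _, _, .bot =>
      { K := Unit
        fin := inferInstance
        dec := inferInstance
        f := GaussHom.det 0 (Sum.elim (fun _ => 0) fun _ => 1)
        o := fun _ => 0 }

/-- The data `A`, `c`, `B Bᵀ` of two soft constraints agree, including the number of rows. -/
def SameData {n r k r' k' : ℕ} (A : Matrix (Fin r) (Fin n) ℝ) (B : Matrix (Fin r) (Fin k) ℝ)
    (c : Fin r → ℝ) (A' : Matrix (Fin r') (Fin n) ℝ) (B' : Matrix (Fin r') (Fin k') ℝ)
    (c' : Fin r' → ℝ) : Prop :=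
  ∃ h : r = r', A = A'.submatrix (Fin.cast h) id ∧ c = c' ∘ Fin.cast h ∧
    B * Bᵀ = (B' * B'ᵀ).submatrix (Fin.cast h) (Fin.cast h)

end ExactCond

namespace ExactCond

/-! ## Value expressions up to derivable equality -/

namespace Aff

variable {n n' n'' : ℕ}

/-! Existence. Conditions commute with one another and move under later samplings, so a term is `⊥`
or a block of samplings `z` followed by a system of affine equations. By SUBS, the equations that a
term absorbs form a linear subspace (`impliedEqs`), so a system matters only through its row space
`V` (`Der.system_of_span_eq`). There are three cases. If `V` contains an equation without `x` but
involving `z`, an orthogonal rotation turns it into an equation for the last bound variable, which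
INIT eliminates (`exists_eliminate`); this is the induction on the number of samplings. If `V`
contains a nonzero constant equated to `0`, the term fails. Otherwise an element of `V` is
determined by its coefficients of `x`; the reduced row echelon basis of the projection of `V` to
these coefficients lifts to a basis of `V`, which is the normal form.

Uniqueness for derivable equality. A term is given the energy `inf |z|²` over the samples compatible
with inputs and outputs. Every rule preserves it up to a finite additive constant (`Der.energyEq`).
A soft constraint has energy `0` exactly where `A x = c`, so the constants cancel and the solution
set is an invariant; it gives the row space of `A`, hence `A` by uniqueness of reduced row echelon
forms, and then `c`. Convex duality recovers the quadratic form of `B Bᵀ` (`le_energy_soft`,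
`gram_le_of_energy_eq`). The energy of `⊥` is infinite everywhere.

Uniqueness for denotations. One test state suffices: a standard normal input together with a copy
(`stdCopy`). Observing `A x - c + N(0, B Bᵀ)` to be `0` has nondegenerate covariance `S = A Aᵀ + B
Bᵀ`, so conditioning succeeds, and the posterior of the copy has mean `G c` and covariance `1 - (G
A)ᵀ`, where `G S = Aᵀ` (`ObsHom.Models.exists_gain`). The product `G A` determines the row space of
`A`, hence `A`, and then `G`, `S` and `c` by cancellation. -/

theorem subst_subst (σ : Fin n → Aff n') (τ : Fin n' → Aff n'') (s : Aff n) :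
    (s.subst σ).subst τ = s.subst fun i => (σ i).subst τ := by
  induction s <;> simp_all [subst]

@[simp]
theorem subst_var (s : Aff n) : s.subst var = s := by
  induction s <;> simp_all [subst]

/-- A value expression in a context extended by one variable. -/
def wk (s : Aff n) : Aff (n + 1) := s.subst fun i => var i.castSucc

theorem wk_subst (s : Aff n) (σ : Fin (n + 1) → Aff n') :
    s.wk.subst σ = s.subst fun i => σ i.castSucc := by
  simp [wk, subst_subst, subst]

theorem lift_subst_lift (σ : Fin n → Aff n') (τ : Fin n' → Aff n'') :
    (fun i => (lift σ i).subst (lift τ)) = lift fun i => (σ i).subst τ := by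
  funext i
  refine Fin.lastCases ?_ (fun i => ?_) i
  · simp [lift, subst]
  · simp [lift, subst_subst, subst]

@[simp]
theorem lift_var : lift (var : Fin n → Aff n) = var := by
  funext i
  refine Fin.lastCases ?_ (fun i => ?_) i <;> simp [lift, subst]

/-- The vector of coefficients of a value expression. -/
def vec (s : Aff n) : (Fin n → ℝ) × ℝ := (s.coeff, s.offset)

@[simp] theorem vec_var (i : Fin n) : (var i).vec = (Pi.single i 1, 0) := rfl
@[simp] theorem vec_add (s t : Aff n) : (add s t).vec = s.vec + t.vec := rfl
@[simp] theorem vec_smul (a : ℝ) (s : Aff n) : (smul a s).vec = a • s.vec := rfl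
@[simp] theorem vec_const (a : ℝ) : (const a : Aff n).vec = (0, a) := rfl
@[simp high] theorem vec_zero : (const 0 : Aff n).vec = 0 := rfl

theorem vec_sum (k : ℕ) (t : Fin k → Aff n) : (sum k t).vec = ∑ i, (t i).vec := by
  induction k with
  | zero => rfl
  | succ k ih => rw [sum, vec_add, ih, Fin.sum_univ_castSucc]

/-- The expression with a given vector of coefficients. -/
def ofVec (v : (Fin n → ℝ) × ℝ) : Aff n := add (row (r := 1) (fun _ => v.1) id 0) (const v.2)

@[simp]
theorem vec_ofVec (v : (Fin n → ℝ) × ℝ) : (ofVec v).vec = v := by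
  ext i <;> simp [ofVec, row, vec_sum, Prod.fst_sum, Prod.snd_sum, Pi.single_apply]

/-- The value of an expression. -/
def eval (s : Aff n) (x : Fin n → ℝ) : ℝ := s.coeff ⬝ᵥ x + s.offset

variable (x : Fin n → ℝ)

@[simp] theorem eval_var (i : Fin n) : (var i).eval x = x i := by simp [eval, coeff, offset]
@[simp] theorem eval_const (a : ℝ) : (const a : Aff n).eval x = a := by simp [eval, coeff, offset]
@[simp] theorem eval_add (s t : Aff n) : (add s t).eval x = s.eval x + t.eval x := by
  simp [eval, coeff, offset, add_dotProduct]; ring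
@[simp] theorem eval_smul (a : ℝ) (s : Aff n) : (smul a s).eval x = a * s.eval x := by
  simp [eval, coeff, offset, smul_dotProduct]; ring

@[simp]
theorem eval_subst (σ : Fin n' → Aff n) (s : Aff n') :
    (s.subst σ).eval x = s.eval fun i => (σ i).eval x := by
  induction s <;> simp_all [subst]

theorem eval_sum (k : ℕ) (t : Fin k → Aff n) : (sum k t).eval x = ∑ i, (t i).eval x := by
  induction k with
  | zero => simp [sum]
  | succ k ih => rw [sum, eval_add, ih, Fin.sum_univ_castSucc]

theorem eval_row {r k : ℕ} (M : Matrix (Fin r) (Fin k) ℝ) (v : Fin k → Fin n) (i : Fin r) :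
    (row M v i).eval x = (M *ᵥ (x ∘ v)) i := by
  simp [row, eval_sum, Matrix.mulVec, dotProduct]

end Aff

/-- Derivable equations hold wherever the hypotheses do. -/
theorem AffDer.eval_eq {n : ℕ} {H : Aff n → Aff n → Prop} {s t : Aff n} (h : AffDer H s t)
    (x : Fin n → ℝ) (hH : ∀ s t, H s t → s.eval x = t.eval x) : s.eval x = t.eval x := by
  induction h with
  | hyp h => exact hH _ _ h
  | refl => rfl
  | symm _ ih => exact ih.symm
  | trans _ _ ih ih' => exact ih.trans ih'
  | _ => first | (simp [*]; done) | (simp; ring)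

/-! ### Completeness: derivability of equations reduces to linear algebra of coefficients -/

section Quotient

variable {n : ℕ} (H : Aff n → Aff n → Prop)

/-- Derivability from `H` as an equivalence relation. -/
def affSetoid : Setoid (Aff n) := ⟨AffDer H, .refl, .symm, .trans⟩

/-- Value expressions modulo derivability from `H`. -/
def AffQuot : Type := Quotient (affSetoid H)

namespace AffQuot

variable {H}

/-- The class of an expression. -/
def mk (s : Aff n) : AffQuot H := Quotient.mk (affSetoid H) s

theorem mk_eq_mk {s t : Aff n} : (mk s : AffQuot H) = mk t ↔ AffDer H s t :=
  ⟨fun h => Quotient.exact h, fun h => Quotient.sound h⟩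

instance : Zero (AffQuot H) := ⟨mk (.const 0)⟩
instance : Add (AffQuot H) :=
  ⟨Quotient.map₂ .add fun _ _ h _ _ h' => AffDer.congr_add h h'⟩
instance : SMul ℝ (AffQuot H) := ⟨fun a => Quotient.map (.smul a) fun _ _ h => .congr_smul a h⟩
instance : Neg (AffQuot H) := ⟨fun q => (-1 : ℝ) • q⟩

theorem mk_add (s t : Aff n) : (mk (.add s t) : AffQuot H) = mk s + mk t := rfl
theorem mk_smul (a : ℝ) (s : Aff n) : (mk (.smul a s) : AffQuot H) = a • mk s := rfl

theorem ind {p : AffQuot H → Prop} (h : ∀ s, p (mk s)) (q : AffQuot H) : p q := Quotient.ind h q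

theorem add_comm' (p q : AffQuot H) : p + q = q + p := by
  induction p using ind; induction q using ind; exact mk_eq_mk.2 (.add_comm _ _)

theorem add_zero' (p : AffQuot H) : p + 0 = p := by
  induction p using ind; exact mk_eq_mk.2 (.add_zero _)

theorem zero_smul' (p : AffQuot H) : (0 : ℝ) • p = 0 := by
  induction p using ind; exact mk_eq_mk.2 (.zero_smul _)

theorem one_smul' (p : AffQuot H) : (1 : ℝ) • p = p := by
  induction p using ind; exact mk_eq_mk.2 (.one_smul _)

theorem add_smul' (a b : ℝ) (p : AffQuot H) : (a + b) • p = a • p + b • p := by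
  induction p using ind; exact mk_eq_mk.2 (.add_smul _ _ _)

instance : AddCommGroup (AffQuot H) where
  add_assoc p q r := by
    induction p using ind; induction q using ind; induction r using ind
    exact mk_eq_mk.2 (.add_assoc _ _ _)
  add_comm := add_comm'
  add_zero := add_zero'
  zero_add p := by rw [add_comm', add_zero']
  nsmul := nsmulRec
  zsmul := zsmulRec
  neg_add_cancel p := by
    have h := add_smul' (-1) 1 p
    rw [neg_add_cancel, zero_smul', one_smul'] at h
    exact h.symm

instance : Module ℝ (AffQuot H) where
  one_smul := one_smul'
  zero_smul := zero_smul'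
  add_smul := add_smul'
  mul_smul a b p := by induction p using ind; exact mk_eq_mk.2 (.mul_smul _ _ _)
  smul_zero a := by
    refine mk_eq_mk.2 ((AffDer.smul_const a 0).trans ?_)
    rw [mul_zero]; exact .refl _
  smul_add a p q := by
    induction p using ind; induction q using ind; exact mk_eq_mk.2 (.smul_add _ _ _)

/-- The linear map from coefficient vectors to classes of expressions. -/
noncomputable def lin : (Fin n → ℝ) × ℝ →ₗ[ℝ] AffQuot H :=
  (Fintype.linearCombination ℝ fun i => (mk (.var i) : AffQuot H)).coprod
    (LinearMap.toSpanSingleton ℝ _ (mk (.const 1)))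

/-- The class of an expression depends only on its coefficients, and linearly so. -/
theorem lin_vec (s : Aff n) : (lin s.vec : AffQuot H) = mk s := by
  induction s with
  | var i => simp [lin, Fintype.linearCombination_apply, Pi.single_apply, ite_smul]
  | add s t hs ht => rw [Aff.vec_add, map_add, hs, ht, mk_add]
  | smul a s hs => rw [Aff.vec_smul, map_smul, hs, mk_smul]
  | const b =>
    simp only [lin, Aff.vec_const, LinearMap.coprod_apply, map_zero, zero_add,
      LinearMap.toSpanSingleton_apply]
    rw [← mk_smul]
    have h := AffDer.smul_const (H := H) b 1
    rw [mul_one] at h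
    exact mk_eq_mk.2 h

end AffQuot

/-- Modulo `s = t`, the linear map `lin` kills the vector of `s - t`, hence all its multiples. -/
theorem affDer_of_vec {s t s' t' : Aff n} (a : ℝ) (h : s'.vec - t'.vec = a • (s.vec - t.vec)) :
    AffDer (fun a b => a = s ∧ b = t) s' t' := by
  rw [← AffQuot.mk_eq_mk, ← sub_eq_zero, ← AffQuot.lin_vec, ← AffQuot.lin_vec, ← map_sub, h,
    map_smul, map_sub, AffQuot.lin_vec, AffQuot.lin_vec,
    AffQuot.mk_eq_mk.2 (.hyp ⟨rfl, rfl⟩), sub_self, smul_zero]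

theorem interderivable_of_vec {s t s' t' : Aff n} {a : ℝ} (ha : a ≠ 0)
    (h : s'.vec - t'.vec = a • (s.vec - t.vec)) : Interderivable s t s' t' :=
  ⟨affDer_of_vec a h, affDer_of_vec a⁻¹ (by rw [h, inv_smul_smul₀ ha])⟩

end Quotient

end ExactCond

namespace ExactCond

/-! ## Derived rules for computations -/

namespace Tm

theorem subst_subst : ∀ {n n' n'' m : ℕ} (σ : Fin n → Aff n') (τ : Fin n' → Aff n'') (t : Tm n m),
    (t.subst σ).subst τ = t.subst fun i => (σ i).subst τ
  | _, _, _, _, σ, τ, nu t => by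
    simp only [subst]; rw [subst_subst, Aff.lift_subst_lift]
  | _, _, _, _, σ, τ, cond s t u => by
    simp only [subst, Aff.subst_subst]; rw [subst_subst]
  | _, _, _, _, σ, τ, ret t => by simp only [subst, Aff.subst_subst]
  | _, _, _, _, _, _, bot => by simp only [subst]

@[simp]
theorem subst_var : ∀ {n m : ℕ} (t : Tm n m), t.subst Aff.var = t
  | _, _, nu t => by simp only [subst, Aff.lift_var]; rw [subst_var]
  | _, _, cond s t u => by simp only [subst, Aff.subst_var]; rw [subst_var]
  | _, _, ret t => by simp only [subst, Aff.subst_var]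
  | _, _, bot => by simp only [subst]

@[simp]
theorem subst_done {n n' : ℕ} (σ : Fin n → Aff n') : (done : Tm n 0).subst σ = done := by
  simp only [done, subst]; congr 1; funext i; exact i.elim0

theorem ret_eq_done {n : ℕ} (t : Fin 0 → Aff n) : ret t = done := by
  simp only [done]; congr 1; funext i; exact i.elim0

@[simp]
theorem done_bind {n l : ℕ} (u : Tm n l) : (done : Tm n 0).bind (l := l) u = u := by
  have h : Fin.append (Aff.var : Fin n → Aff n) Fin.elim0 = Aff.var := Fin.append_elim0 _
  simp only [done, bind]
  rw [h]; exact subst_var u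

/-- A computation in a context extended by one variable. -/
def wk {n m : ℕ} (t : Tm n m) : Tm (n + 1) m := t.subst fun i => .var i.castSucc

/-- Binding a continuation to a freshly sampled variable composes two renamings whose composite is
the identity. -/
theorem append_subst_last {n : ℕ} : (fun i : Fin (n + 1) => (Fin.append
    (fun i : Fin n => Aff.var (Fin.castAdd 1 i.castSucc))
    (fun j : Fin 1 => Aff.var (Fin.natAdd (n + 1) j)) i).subst
      (Fin.append Aff.var fun _ : Fin 1 => Aff.var (Fin.last n))) = Aff.var := by
  funext i
  induction i using Fin.addCases with
  | left i => simp only [Fin.append_left, Aff.subst]; rfl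
  | right i =>
    simp only [Fin.append_right, Aff.subst]
    congr 1; ext; simp

theorem nus_bind {n m l : ℕ} : ∀ (k : ℕ) (t : Tm (n + k) m) (u : Tm (n + m) l),
    (nus k t).bind u = nus k (t.bind (u.subst (Fin.append
      (fun i : Fin n => Aff.var (Fin.castAdd m (Fin.castAdd k i)))
      fun j : Fin m => Aff.var (Fin.natAdd (n + k) j))))
  | 0, t, u => by
    simp only [nus]
    conv_lhs => rw [← subst_var u]
    congr 2
    funext i
    induction i using Fin.addCases <;> simp
  | k + 1, t, u => by
    simp only [nus]
    rw [nus_bind k]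
    simp only [bind]
    rw [subst_subst]
    congr 4
    funext i
    induction i using Fin.addCases <;> simp [Aff.subst] <;> rfl

theorem conds_subst {n n' m : ℕ} (σ : Fin n → Aff n') : ∀ (r : ℕ) (s t : Fin r → Aff n)
    (u : Tm n m), (conds r s t u).subst σ =
      conds r (fun i => (s i).subst σ) (fun i => (t i).subst σ) (u.subst σ)
  | 0, _, _, _ => rfl
  | r + 1, s, t, u => by
    simp only [conds, subst]
    rw [conds_subst σ r]

end Tm

open Tm

namespace Der

variable {n m : ℕ}

theorem of_eq {t u : Tm n m} (h : t = u) : Der t u := h ▸ refl t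

theorem congr_cond' (s t : Aff n) {u u' : Tm n m} (h : Der u u') :
    Der (cond s t u) (cond s t u') := congr_cond (.refl _) (.refl _) h

theorem bind_unit {t t' : Tm n 0} (h : Der t t') (u : Tm n m) :
    Der (Tm.bind (n := n) (m := 0) (l := m) t u) (Tm.bind (n := n) (m := 0) (l := m) t' u) :=
  h.bind (refl _)

/-- The axioms end in a bare return; binding `u` to it yields the same rule with an arbitrary
continuation. The following rules arise in the same way. -/
theorem cond_cong {s t s' t' : Aff n} (h : Interderivable s t s' t') (u : Tm n m) :
    Der (cond s t u) (cond s' t' u) := by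
  simpa [Tm.bind] using (cong h).bind_unit u

theorem cond_swap (a b c d : Aff n) (u : Tm n m) :
    Der (cond a b (cond c d u)) (cond c d (cond a b u)) := by
  simpa [Tm.bind] using (cond_comm a b c d).bind_unit u

theorem cond_self (a : Aff n) (u : Tm n m) : Der (cond a a u) u := by
  simpa [Tm.bind] using (taut a).bind_unit u

theorem cond_subst (a b : Aff n) (u : Tm (n + 1) m) :
    Der (cond a b (u.subst (Fin.snoc .var a))) (cond a b (u.subst (Fin.snoc .var b))) := by
  have h := (subs a b).bind (refl u)
  simp only [Tm.bind] at h
  rwa [Fin.append_right_eq_snoc, Fin.append_right_eq_snoc] at h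

theorem cond_zero_one (u : Tm n 0) : Der (cond (.const 0) (.const 1) u) .bot := by
  simpa [Tm.bind] using (fail (n := n)).bind_unit u

theorem cond_nu (a b : Aff n) (t : Tm (n + 1) m) :
    Der (cond a b (nu t)) (nu (cond a.wk b.wk t)) := by
  have h := (nu_comm_cond a b).bind (u := (t : Tm (n + 1) m)) (refl _)
  simp only [Tm.bind, Tm.subst_subst] at h
  rw [Tm.append_subst_last, Tm.subst_var] at h
  exact h

theorem nu_cond_const (c : ℝ) (u : Tm (n + 1) m) :
    Der (nu (cond (.var (Fin.last n)) (.const c) u)) (u.subst (Fin.snoc .var (.const c))) := by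
  have h := (init (n := n) c).bind (u := (u : Tm (n + 1) m)) (refl _)
  simp only [Tm.bind, Tm.subst_subst] at h
  rw [Tm.append_subst_last, Tm.subst_var, Fin.append_right_eq_snoc] at h
  exact h

/-- Failure is rewritten as the condition `0 = 1`, which moves out of the sampling. -/
theorem nu_bot : Der (nu .bot : Tm n 0) .bot := by
  refine (congr_nu fail.symm).trans ?_
  exact (cond_nu (n := n) (.const 0) (.const 1) done).symm.trans (cond_zero_one _)

theorem congr_nus (k : ℕ) {t t' : Tm (n + k) m} (h : Der t t') : Der (nus k t) (nus k t') := by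
  induction k with
  | zero => exact h
  | succ k ih => exact ih h.congr_nu

theorem nus_bot (k : ℕ) : Der (nus k .bot : Tm n 0) .bot := by
  induction k with
  | zero => exact .refl _
  | succ k ih => exact (congr_nus k nu_bot).trans ih

theorem conds_bot (r : ℕ) (s t : Fin r → Aff n) : Der (conds r s t (.bot : Tm n m)) .bot := by
  induction r with
  | zero => exact .refl _
  | succ r ih => exact (congr_cond' _ _ (ih _ _)).trans (cond_bot _ _)

theorem conds_nu (r : ℕ) (s t : Fin r → Aff n) (u : Tm (n + 1) m) :
    Der (conds r s t (nu u)) (nu (conds r (fun i => (s i).wk) (fun i => (t i).wk) u)) := by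
  induction r with
  | zero => exact .refl _
  | succ r ih => exact (congr_cond' _ _ (ih _ _)).trans (cond_nu _ _ _)

theorem conds_cond (r : ℕ) (s t : Fin r → Aff n) (a b : Aff n) (u : Tm n m) :
    Der (conds r s t (cond a b u)) (cond a b (conds r s t u)) := by
  induction r with
  | zero => exact .refl _
  | succ r ih => exact (congr_cond' _ _ (ih _ _)).trans (cond_swap _ _ _ _ _)

/-- Rotation of the bound variables. -/
theorem nus_rotate {k : ℕ} {U : Matrix (Fin k) (Fin k) ℝ}
    (hU : U ∈ Matrix.orthogonalGroup (Fin k) ℝ) (t : Tm (n + k) m) :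
    Der (nus k (t.subst (Fin.append (fun i => .var (Fin.castAdd k i))
      (Aff.row U (Fin.natAdd n))))) (nus k t) := by
  have h := (orth (n := n) U hU).bind (refl t)
  rw [nus_bind, nus_bind] at h
  simp only [Tm.bind, Tm.subst_subst] at h
  have e (f : Fin k → Aff (n + k)) : (fun i : Fin (n + k) => (Fin.append
      (fun i : Fin n => Aff.var (Fin.castAdd k (Fin.castAdd k i)))
      (fun j : Fin k => Aff.var (Fin.natAdd (n + k) j)) i).subst
        (Fin.append Aff.var f)) = Fin.append (fun i => .var (Fin.castAdd k i)) f := by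
    funext i
    induction i using Fin.addCases <;> simp [Aff.subst]
  rw [e, e] at h
  refine h.trans (of_eq ?_)
  conv_rhs => rw [← subst_var t]
  congr 2
  funext i
  induction i using Fin.addCases <;> simp

end Der

/-! ### Systems of equations -/

/-- The system `v₀ = 0, …, vᵣ₋₁ = 0`. -/
def system {n r : ℕ} (v : Fin r → (Fin n → ℝ) × ℝ) : Tm n 0 :=
  conds r (fun i => .ofVec (v i)) (fun _ => .const 0) done

section System

variable {n m : ℕ}

theorem Der.cond_vec {s t s' t' : Aff n} (h : s.vec - t.vec = s'.vec - t'.vec) (u : Tm n m) :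
    Der (cond s t u) (cond s' t' u) :=
  cond_cong (interderivable_of_vec one_ne_zero (by rw [one_smul, h])) u

theorem Der.conds_system {r : ℕ} (s t : Fin r → Aff n) :
    Der (conds r s t done) (system fun i => (s i).vec - (t i).vec) := by
  induction r with
  | zero => exact .refl _
  | succ r ih =>
    refine (congr_cond' _ _ (ih _ _)).trans ?_
    refine cond_vec ?_ _
    simp

/-- The equations that hold in `u`. -/
def impliedEqs (u : Tm n m) : Submodule ℝ ((Fin n → ℝ) × ℝ) where
  carrier := {v | Der (cond (.ofVec v) (.const 0) u) u}
  zero_mem' := (Der.cond_vec (by simp) u).trans (Der.cond_self (.const 0) u)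
  smul_mem' a v hv := by
    rcases eq_or_ne a 0 with rfl | ha
    -- Scaling by `0` gives a trivial equation; only nonzero scalings are interderivable.
    · exact (Der.cond_vec (by simp) u).trans (Der.cond_self (.const 0) u)
    · refine (Der.cond_cong ?_ u).trans hv
      refine interderivable_of_vec (inv_ne_zero ha) ?_
      simp [inv_smul_smul₀ ha]
  add_mem' {v w} hv hw := by
    -- Under the condition `v = 0`, SUBS replaces `v` by `0` inside the condition `v + w = 0`,
    -- leaving `w = 0`.
    have key := Der.cond_subst (.ofVec v) (.const 0)
      (cond (.add (.var (Fin.last n)) (Aff.ofVec w).wk) (.const 0) u.wk)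
    have e (a : Aff n) : (cond (.add (.var (Fin.last n)) (Aff.ofVec w).wk) (.const 0) u.wk).subst
        (Fin.snoc .var a) = cond (.add a (.ofVec w)) (.const 0) u := by
      simp [Tm.subst, Tm.wk, Tm.subst_subst, Aff.wk_subst, Aff.subst]
    rw [e, e] at key
    have h1 : Der (cond (.add (.ofVec v) (.ofVec w)) (.const 0) u)
        (cond (.ofVec v) (.const 0) (cond (.add (.ofVec v) (.ofVec w)) (.const 0) u)) :=
      (Der.congr_cond' _ _ hv.symm).trans (Der.cond_swap _ _ _ _ _)
    have h2 : Der (cond (.ofVec (v + w)) (.const 0) u)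
        (cond (.add (.ofVec v) (.ofVec w)) (.const 0) u) := Der.cond_vec (by simp) u
    have h3 : Der (cond (.add (.const 0) (.ofVec w)) (.const 0) u) u :=
      (Der.cond_vec (by simp) u).trans hw
    exact h2.trans (h1.trans (key.trans ((Der.congr_cond' _ _ h3).trans hv)))

/-- SUBS turns a repeated condition into `0 = 0`, which TAUT removes. -/
theorem impliedEqs_cond_self (v : (Fin n → ℝ) × ℝ) (u : Tm n m) :
    v ∈ impliedEqs (cond (.ofVec v) (.const 0) u) := by
  have key := Der.cond_subst (.ofVec v) (.const 0) (cond (.var (Fin.last n)) (.const 0) u.wk)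
  have e (a : Aff n) : (cond (.var (Fin.last n)) (.const 0) u.wk).subst
      (Fin.snoc .var a) = cond a (.const 0) u := by
    simp [Tm.subst, Tm.wk, Tm.subst_subst, Aff.subst]
  rw [e, e] at key
  exact key.trans (Der.congr_cond' _ _ (Der.cond_self _ _))

theorem impliedEqs_le_cond (s t : Aff n) (u : Tm n m) :
    impliedEqs u ≤ impliedEqs (cond s t u) := fun _ hv =>
  (Der.cond_swap _ _ _ _ _).trans (Der.congr_cond' _ _ hv)

theorem system_succ {r : ℕ} (v : Fin (r + 1) → (Fin n → ℝ) × ℝ) :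
    system v = cond (.ofVec (v 0)) (.const 0) (system fun i => v i.succ) := rfl

theorem mem_impliedEqs_system {r : ℕ} (v : Fin r → (Fin n → ℝ) × ℝ) (i : Fin r) :
    v i ∈ impliedEqs (system v) := by
  induction r with
  | zero => exact i.elim0
  | succ r ih =>
    rw [system_succ]
    induction i using Fin.cases with
    | zero => exact impliedEqs_cond_self _ _
    | succ i => exact impliedEqs_le_cond _ _ _ (ih (fun i => v i.succ) i)

theorem span_le_impliedEqs {r : ℕ} (v : Fin r → (Fin n → ℝ) × ℝ) :
    Submodule.span ℝ (Set.range v) ≤ impliedEqs (system v) :=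
  Submodule.span_le.2 (Set.range_subset_iff.2 (mem_impliedEqs_system v))

theorem Der.conds_of_mem {r : ℕ} (v : Fin r → (Fin n → ℝ) × ℝ) {u : Tm n m}
    (h : ∀ i, v i ∈ impliedEqs u) :
    Der (conds r (fun i => .ofVec (v i)) (fun _ => .const 0) u) u := by
  induction r with
  | zero => exact .refl _
  | succ r ih => exact (congr_cond' _ _ (ih _ fun i => h i.succ)).trans (h 0)

theorem Der.conds_system_swap {r r' : ℕ} (v : Fin r → (Fin n → ℝ) × ℝ)
    (w : Fin r' → (Fin n → ℝ) × ℝ) :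
    Der (conds r (fun i => .ofVec (v i)) (fun _ => .const 0) (system w))
      (conds r' (fun i => .ofVec (w i)) (fun _ => .const 0) (system v)) := by
  induction r with
  | zero => exact .refl _
  | succ r ih =>
    exact (congr_cond' _ _ (ih _)).trans (conds_cond _ _ _ _ _ _).symm

/-- Systems with the same row space are derivably equal. -/
theorem Der.system_of_span_eq {r r' : ℕ} {v : Fin r → (Fin n → ℝ) × ℝ}
    {w : Fin r' → (Fin n → ℝ) × ℝ}
    (h : Submodule.span ℝ (Set.range v) = Submodule.span ℝ (Set.range w)) :
    Der (system v) (system w) := by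
  have hv : ∀ i, v i ∈ impliedEqs (system w) := fun i =>
    span_le_impliedEqs w (h ▸ Submodule.subset_span ⟨i, rfl⟩)
  have hw : ∀ i, w i ∈ impliedEqs (system v) := fun i =>
    span_le_impliedEqs v (h ▸ Submodule.subset_span ⟨i, rfl⟩)
  -- Each system absorbs the equations of the other, and the two blocks commute.
  exact (conds_of_mem w hw).symm.trans ((conds_system_swap w v).trans (conds_of_mem v hv))

end System

end ExactCond

namespace ExactCond

/-! ## Reduced row echelon forms of subspaces -/

section RREF

variable {n : ℕ}

/-- `j` is the position of the first nonzero entry of `v`. -/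
def LeadsAt (v : Fin n → ℝ) (j : Fin n) : Prop := v j ≠ 0 ∧ ∀ j' < j, v j' = 0

theorem exists_leadsAt {v : Fin n → ℝ} (hv : v ≠ 0) : ∃ j, LeadsAt v j := by
  classical
  obtain ⟨j, hj⟩ := Function.ne_iff.1 hv
  have hne : (Finset.univ.filter fun j => v j ≠ 0).Nonempty := ⟨j, by simpa using hj⟩
  refine ⟨Finset.min' _ hne, by simpa using Finset.min'_mem _ hne, fun j' hj' => ?_⟩
  by_contra h
  exact absurd (Finset.min'_le _ j' (by simpa using h)) (not_le.2 hj')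

/-- The pivots are the leading positions of vectors of `V`. One vector is chosen for each pivot, and
the chosen family is normalized so that its pivot columns form the identity. -/
theorem exists_isRREF_span_eq (V : Submodule ℝ (Fin n → ℝ)) :
    ∃ (r : ℕ) (A : Matrix (Fin r) (Fin n) ℝ), IsRREF A ∧ (∀ i, A i ≠ 0) ∧
      Submodule.span ℝ (Set.range A) = V := by
  classical
  let P : Finset (Fin n) := Finset.univ.filter fun j => ∃ v ∈ V, LeadsAt v j
  have hP {j} : j ∈ P ↔ ∃ v ∈ V, LeadsAt v j := by simp [P]
  let p : Fin P.card ↪o Fin n := P.orderEmbOfFin rfl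
  have hp (i) : p i ∈ P := P.orderEmbOfFin_mem rfl i
  have hp' {j} (hj : j ∈ P) : ∃ i, p i = j := by
    have : j ∈ Set.range p := by rw [Finset.range_orderEmbOfFin]; exact hj
    exact this
  choose v hvV hv using fun i => hP.1 (hp i)
  -- The pivot columns of the chosen vectors: upper triangular with nonzero diagonal, since `v i`
  -- leads at `p i`.
  let M : Matrix (Fin P.card) (Fin P.card) ℝ := Matrix.of fun i k => v i (p k)
  have hM : IsUnit M.det := by
    rw [Matrix.det_of_isUpperTriangular (M := M) (fun i k hk => (hv i).2 _ (p.strictMono hk)),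
      isUnit_iff_ne_zero, Finset.prod_ne_zero_iff]
    exact fun i _ => (hv i).1
  let A : Matrix (Fin P.card) (Fin n) ℝ := fun i => ∑ k, M⁻¹ i k • v k
  have hAV (i) : A i ∈ V := V.sum_mem fun k _ => V.smul_mem _ (hvV k)
  have hAp (i k) : A i (p k) = (1 : Matrix (Fin P.card) (Fin P.card) ℝ) i k := by
    rw [← Matrix.nonsing_inv_mul M hM]
    simp [A, M, Matrix.mul_apply]
  have hlead {i j} (h : LeadsAt (A i) j) : j = p i := by
    obtain ⟨k, rfl⟩ := hp' (hP.2 ⟨_, hAV i, h⟩)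
    have := h.1
    rw [hAp, Matrix.one_apply] at this
    rw [show i = k by by_contra hne; simp [hne] at this]
  have hne (i) : A i ≠ 0 := fun h => by simpa [h] using hAp i i
  refine ⟨P.card, A, ⟨fun i _ _ h => absurd h (hne i), fun i i' j j' hlt h h' => ?_,
    fun i j h => ?_, fun i j h i' hi' => ?_⟩, hne, le_antisymm ?_ fun w hw => ?_⟩
  · rw [hlead h, hlead h']; exact p.strictMono hlt
  · rw [hlead h, hAp, Matrix.one_apply_eq]
  · rw [hlead h, hAp, Matrix.one_apply_ne hi']
  · exact Submodule.span_le.2 (Set.range_subset_iff.2 hAV)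
  · have hsum : ∑ i, w (p i) • A i ∈ Submodule.span ℝ (Set.range A) :=
      Submodule.sum_mem _ fun i _ => Submodule.smul_mem _ _ (Submodule.subset_span ⟨i, rfl⟩)
    -- The difference lies in `V` and vanishes at every pivot, so it has no possible leading
    -- position.
    suffices h : w - ∑ i, w (p i) • A i = 0 by rwa [sub_eq_zero.1 h]
    by_contra h
    obtain ⟨j, hj⟩ := exists_leadsAt h
    obtain ⟨k, rfl⟩ := hp' (hP.2 ⟨_, V.sub_mem hw
      (V.sum_mem fun i _ => V.smul_mem _ (hAV i)), hj⟩)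
    exact hj.1 (by simp [hAp, Matrix.one_apply])

variable {r r' : ℕ} {A : Matrix (Fin r) (Fin n) ℝ} {A' : Matrix (Fin r') (Fin n) ℝ}

theorem IsRREF.exists_pivots (hA : IsRREF A) (h0 : ∀ i, A i ≠ 0) :
    ∃ p : Fin r → Fin n, StrictMono p ∧ (∀ i, LeadsAt (A i) (p i)) ∧
      ∀ i k, A i (p k) = if i = k then 1 else 0 := by
  choose p hp using fun i => exists_leadsAt (h0 i)
  refine ⟨p, fun i i' h => hA.staircase i i' _ _ h (hp i) (hp i'), hp, fun i k => ?_⟩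
  split_ifs with h
  · subst h; exact hA.leading_one _ _ (hp i)
  · exact hA.leading_column k _ (hp k) i h

theorem IsRREF.exists_rightInverse (hA : IsRREF A) (h0 : ∀ i, A i ≠ 0) :
    ∃ R : Matrix (Fin n) (Fin r) ℝ, A * R = 1 := by
  obtain ⟨p, -, -, hp⟩ := hA.exists_pivots h0
  refine ⟨Matrix.of fun j i => if j = p i then 1 else 0, ?_⟩
  ext i k
  simp [Matrix.mul_apply, hp, Matrix.one_apply]

theorem mem_span_rows {p : Fin r → Fin n} (hp : ∀ i k, A i (p k) = if i = k then 1 else 0)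
    {v : Fin n → ℝ} (hv : v ∈ Submodule.span ℝ (Set.range A)) : v = ∑ i, v (p i) • A i := by
  obtain ⟨c, rfl⟩ := (Submodule.mem_span_range_iff_exists_fun ℝ).1 hv
  refine Finset.sum_congr rfl fun i _ => ?_
  simp [hp]

/-- The pivots are described by the row space alone, which is what makes the echelon form unique. -/
theorem range_pivots {p : Fin r → Fin n} (hp : ∀ i k, A i (p k) = if i = k then 1 else 0)
    (hl : ∀ i, LeadsAt (A i) (p i)) :
    Set.range p = {j | ∃ v ∈ Submodule.span ℝ (Set.range A), LeadsAt v j} := by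
  ext j
  constructor
  · rintro ⟨i, rfl⟩
    exact ⟨A i, Submodule.subset_span ⟨i, rfl⟩, hl i⟩
  · rintro ⟨v, hv, hj⟩
    have h1 := hj.1
    rw [mem_span_rows hp hv, Finset.sum_apply] at h1
    obtain ⟨i, -, hi⟩ := Finset.exists_ne_zero_of_sum_ne_zero h1
    rw [Pi.smul_apply, smul_eq_mul] at hi
    -- A nonzero `A i j` cannot precede the pivot `p i`, and a nonzero `v (p i)` cannot precede the
    -- leading position `j` of `v`.
    refine ⟨i, le_antisymm ?_ ?_⟩
    · by_contra hlt
      exact right_ne_zero_of_mul hi ((hl i).2 _ (not_le.1 hlt))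
    · by_contra hlt
      exact left_ne_zero_of_mul hi (hj.2 _ (not_le.1 hlt))

/-- The reduced row echelon form of a subspace is unique. -/
theorem IsRREF.eq_of_span_eq (hA : IsRREF A) (h0 : ∀ i, A i ≠ 0) (hA' : IsRREF A')
    (h0' : ∀ i, A' i ≠ 0)
    (h : Submodule.span ℝ (Set.range A) = Submodule.span ℝ (Set.range A')) :
    ∃ e : r = r', A = A'.submatrix (Fin.cast e) id := by
  obtain ⟨p, hpm, hl, hp⟩ := hA.exists_pivots h0
  obtain ⟨p', hpm', hl', hp'⟩ := hA'.exists_pivots h0'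
  have hr : Set.range p = Set.range p' := by rw [range_pivots hp hl, range_pivots hp' hl', h]
  have e : r = r' := by
    have h1 := Set.ncard_range_of_injective hpm.injective
    have h2 := Set.ncard_range_of_injective hpm'.injective
    rw [hr, h2] at h1
    simpa using h1.symm
  subst e
  refine ⟨rfl, ?_⟩
  have hpp : p = p' := (StrictMono.range_inj hpm hpm').1 hr
  subst hpp
  ext i j
  have := mem_span_rows hp' (h ▸ Submodule.subset_span ⟨i, rfl⟩ : A i ∈ _)
  rw [this]
  simp [hp, Finset.sum_apply, ite_apply]

theorem span_rows_mul_le {m : ℕ} (M : Matrix (Fin m) (Fin r) ℝ) (A : Matrix (Fin r) (Fin n) ℝ) :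
    Submodule.span ℝ (Set.range (M * A)) ≤ Submodule.span ℝ (Set.range A) := by
  refine Submodule.span_le.2 (Set.range_subset_iff.2 fun i => ?_)
  have : (M * A) i = ∑ k, M i k • A k := by ext j; simp [Matrix.mul_apply]
  rw [this]
  exact Submodule.sum_mem _ fun k _ => Submodule.smul_mem _ _ (Submodule.subset_span ⟨k, rfl⟩)

end RREF

/-- The columns of `U` are an orthonormal basis whose last member is `b` normalized; `a` is the norm
of `b`. -/
theorem exists_orthogonal_vecMul_eq_single {k : ℕ} {b : Fin (k + 1) → ℝ} (hb : b ≠ 0) :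
    ∃ U ∈ Matrix.orthogonalGroup (Fin (k + 1)) ℝ, ∃ a : ℝ, a ≠ 0 ∧
      b ᵥ* U = Pi.single (Fin.last k) a := by
  let b' : EuclideanSpace ℝ (Fin (k + 1)) := WithLp.toLp 2 b
  have hb' : ‖b'‖ ≠ 0 := by
    rw [norm_ne_zero_iff]
    intro h
    exact hb (congrArg WithLp.ofLp h)
  let v : Fin (k + 1) → EuclideanSpace ℝ (Fin (k + 1)) := fun _ => ‖b'‖⁻¹ • b'
  have hv : Orthonormal ℝ (({Fin.last k} : Set (Fin (k + 1))).domRestrict v) := by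
    refine ⟨fun i => ?_, fun i j hij => (hij (Subsingleton.elim _ _)).elim⟩
    simp [Set.domRestrict_apply, v, norm_smul, hb']
  obtain ⟨e, he⟩ := hv.exists_orthonormalBasis_extension_of_card_eq (by simp)
  have hel : e (Fin.last k) = ‖b'‖⁻¹ • b' := he _ rfl
  have hbe : b' = ‖b'‖ • e (Fin.last k) := by rw [hel, smul_inv_smul₀ hb']
  have hin (i j) : ∑ l, e i l * e j l = if i = j then 1 else 0 := by
    have := orthonormal_iff_ite.1 e.orthonormal i j
    rw [← this, PiLp.inner_apply]
    simp [mul_comm]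
  refine ⟨Matrix.of fun i j => e j i, ?_, ‖b'‖, hb', ?_⟩
  · rw [Matrix.mem_orthogonalGroup_iff']
    ext i j
    simp [Matrix.mul_apply, Matrix.one_apply, hin]
  · ext j
    have h1 (l) : b l = ‖b'‖ * e (Fin.last k) l := by
      conv_lhs => rw [show b l = b' l from rfl, hbe]
      simp
    simp only [Matrix.vecMul, dotProduct, Matrix.of_apply, h1, mul_assoc, ← Finset.mul_sum, hin]
    simp [Pi.single_apply, eq_comm]

end ExactCond

namespace ExactCond

/-! ## Normal forms -/

open Tm

theorem Aff.eval_eq_vec {n : ℕ} (s : Aff n) (x : Fin n → ℝ) :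
    s.eval x = s.vec.1 ⬝ᵥ x + s.vec.2 := rfl

theorem Aff.vec_eq_of_eval {n : ℕ} {s t : Aff n} (h : ∀ x, s.eval x = t.eval x) :
    s.vec = t.vec := by
  have h0 : s.vec.2 = t.vec.2 := by simpa [Aff.eval_eq_vec] using h 0
  refine Prod.ext (funext fun i => ?_) h0
  simpa [Aff.eval_eq_vec, h0] using h (Pi.single i 1)

theorem Aff.vec_sub_eq_of_eval {n : ℕ} {s t : Aff n} {v : (Fin n → ℝ) × ℝ} {a : ℝ}
    (h : ∀ x, s.eval x - t.eval x = a * (v.1 ⬝ᵥ x + v.2)) : s.vec - t.vec = a • v := by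
  have := Aff.vec_eq_of_eval (s := .add s (.smul (-1) t)) (t := .smul a (.ofVec v))
    (fun x => by
      rw [Aff.eval_smul, Aff.eval_eq_vec (.ofVec v), Aff.vec_ofVec, ← h]
      simp; ring)
  simpa [sub_eq_add_neg] using this

theorem interderivable_of_eval {n : ℕ} {s t s' t' : Aff n} {a : ℝ} (ha : a ≠ 0)
    (h : ∀ x, s'.eval x - t'.eval x = a * (s.eval x - t.eval x)) : Interderivable s t s' t' := by
  refine interderivable_of_vec ha (Aff.vec_sub_eq_of_eval fun x => ?_)
  rw [h, Aff.eval_eq_vec, Aff.eval_eq_vec]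
  simp only [Prod.fst_sub, Prod.snd_sub, sub_dotProduct]; ring

variable {n : ℕ}

/-- `u` is derivably equal to a normal form. -/
def HasNormalForm (u : Tm n 0) : Prop :=
  Der u .bot ∨
    ∃ (r k : ℕ) (A : Matrix (Fin r) (Fin n) ℝ) (B : Matrix (Fin r) (Fin k) ℝ) (c : Fin r → ℝ),
      IsRREF A ∧ (∀ i, A i ≠ 0) ∧ Der u (.soft A B c)

theorem HasNormalForm.of_der {u u' : Tm n 0} (h : Der u u') (h' : HasNormalForm u') :
    HasNormalForm u := by
  rcases h' with h' | ⟨r, k, A, B, c, hA, h0, h'⟩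
  · exact .inl (h.trans h')
  · exact .inr ⟨r, k, A, B, c, hA, h0, h.trans h'⟩

/-- An equation between bound variables allows one of them to be eliminated. -/
theorem exists_eliminate {k r : ℕ} {v : Fin r → (Fin (n + (k + 1)) → ℝ) × ℝ}
    {w : (Fin (n + (k + 1)) → ℝ) × ℝ} (hw : w ∈ Submodule.span ℝ (Set.range v))
    (h0 : ∀ i, w.1 (Fin.castAdd (k + 1) i) = 0) (h1 : (fun j => w.1 (Fin.natAdd n j)) ≠ 0) :
    ∃ v' : Fin r → (Fin (n + k) → ℝ) × ℝ, Der (nus (k + 1) (system v)) (nus k (system v')) := by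
  obtain ⟨U, hU, a, ha, hUa⟩ := exists_orthogonal_vecMul_eq_single h1
  set ρ : Fin (n + (k + 1)) → Aff (n + (k + 1)) :=
    Fin.append (fun i => .var (Fin.castAdd (k + 1) i)) (Aff.row U (Fin.natAdd n)) with hρ
  -- As `w` does not involve `x`, the rotation leaves only the last bound variable in it.
  have heval (x : Fin (n + (k + 1)) → ℝ) :
      ((Aff.ofVec w).subst ρ).eval x = a * x (Fin.last (n + k)) + w.2 := by
    have h2 : (fun i => (ρ (Fin.castAdd (k + 1) i)).eval x) = x ∘ Fin.castAdd (k + 1) := by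
      funext i; simp [hρ]
    have h3 : (fun j => (ρ (Fin.natAdd n j)).eval x) = U *ᵥ (x ∘ Fin.natAdd n) := by
      funext j; simp [hρ, Aff.eval_row]
    rw [Aff.eval_subst, Aff.eval_eq_vec, Aff.vec_ofVec]
    have h4 : w.1 ⬝ᵥ (fun i => (ρ i).eval x) =
        (fun j => w.1 (Fin.natAdd n j)) ⬝ᵥ (U *ᵥ (x ∘ Fin.natAdd n)) := by
      rw [← h3]
      simp only [dotProduct]
      rw [Fin.sum_univ_add]
      simp [h0]
    rw [h4, Matrix.dotProduct_mulVec, hUa, single_dotProduct]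
    rfl
  have hs : Der (system v) (cond (.ofVec w) (.const 0) (system v)) :=
    (span_le_impliedEqs v hw).symm
  have hi : Interderivable ((Aff.ofVec w).subst ρ) (.const 0) (.var (Fin.last (n + k)))
      (.const (-w.2 / a)) := by
    refine interderivable_of_eval (inv_ne_zero ha) fun x => ?_
    rw [heval]
    simp only [Aff.eval_var, Aff.eval_const]
    field_simp
    ring
  have he : (((system v).subst ρ).subst (Fin.snoc .var (.const (-w.2 / a))) : Tm (n + k) 0) =
      conds r (fun i => ((Aff.ofVec (v i)).subst ρ).subst (Fin.snoc .var (.const (-w.2 / a))))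
        (fun _ => .const 0) done := by
    simp only [system, conds_subst, subst_done, Aff.subst]
  exact ⟨_, (Der.nus_rotate hU (system v)).symm.trans ((Der.congr_nus (k + 1)
    ((hs.subst ρ).trans (Der.cond_cong hi _))).trans (Der.congr_nus k
      ((Der.nu_cond_const (-w.2 / a) _).trans ((Der.of_eq he).trans (Der.conds_system _ _)))))⟩

/-- The case distinction shared by both steps of the induction on `k`. The argument of type `Fin k`
in `helim` records that `k` is positive, so that the hypothesis is vacuous for `k = 0`. -/
theorem hasNormalForm_system_of_eliminate {k r : ℕ} (v : Fin r → (Fin (n + k) → ℝ) × ℝ)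
    (helim : Fin k → ∀ w ∈ Submodule.span ℝ (Set.range v),
      (∀ i, w.1 (Fin.castAdd k i) = 0) → (fun j => w.1 (Fin.natAdd n j)) ≠ 0 →
        HasNormalForm (nus k (system v))) : HasNormalForm (nus k (system v)) := by
  set V := Submodule.span ℝ (Set.range v) with hV
  by_cases h1 : ∃ w ∈ V, (∀ i, w.1 (Fin.castAdd k i) = 0) ∧
      (fun j => w.1 (Fin.natAdd n j)) ≠ 0
  · obtain ⟨w, hw, hx, hz⟩ := h1
    obtain ⟨j, -⟩ := Function.ne_iff.1 hz
    exact helim j w hw hx hz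
  by_cases h2 : ∃ w ∈ V, (∀ i, w.1 (Fin.castAdd k i) = 0) ∧ w.2 ≠ 0
  · obtain ⟨w, hw, hx, hc⟩ := h2
    have hz : (fun j => w.1 (Fin.natAdd n j)) = 0 := by
      by_contra hz
      exact h1 ⟨w, hw, hx, hz⟩
    have hw1 : w.1 = 0 := by
      funext i
      induction i using Fin.addCases with
      | left i => exact hx i
      | right j => exact congrFun hz j
    have hi : Interderivable (.ofVec w) (.const 0) (.const 0 : Aff (n + k)) (.const 1) := by
      refine interderivable_of_eval (neg_ne_zero.2 (inv_ne_zero hc)) fun x => ?_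
      rw [Aff.eval_eq_vec (.ofVec w), Aff.vec_ofVec, hw1]
      simp [hc]
    refine .inl ((Der.congr_nus k ?_).trans (Der.nus_bot k))
    exact (Der.symm (span_le_impliedEqs v hw)).trans
      ((Der.cond_cong hi _).trans (Der.cond_zero_one _))
  -- In the remaining case the projection of `V` to the coefficients of `x` is injective.
  have hinj : ∀ w ∈ V, (∀ i, w.1 (Fin.castAdd k i) = 0) → w = 0 := fun w hw hx => by
    have hz : (fun j => w.1 (Fin.natAdd n j)) = 0 := by
      by_contra hz
      exact h1 ⟨w, hw, hx, hz⟩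
    have hc : w.2 = 0 := by
      by_contra hc
      exact h2 ⟨w, hw, hx, hc⟩
    refine Prod.ext (funext fun i => ?_) hc
    induction i using Fin.addCases with
    | left i => exact hx i
    | right j => exact congrFun hz j
  let L : (Fin (n + k) → ℝ) × ℝ →ₗ[ℝ] (Fin n → ℝ) :=
    LinearMap.funLeft ℝ ℝ (Fin.castAdd k) ∘ₗ LinearMap.fst ℝ _ _
  have hL (w i) : L w i = w.1 (Fin.castAdd k i) := rfl
  obtain ⟨r', A, hA, h0, hspan⟩ := exists_isRREF_span_eq (V.map L)
  have hAV (i) : A i ∈ V.map L := hspan ▸ Submodule.subset_span ⟨i, rfl⟩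
  choose w hwV hw using fun i => Submodule.mem_map.1 (hAV i)
  have hVw : V = Submodule.span ℝ (Set.range w) := by
    refine le_antisymm (fun y hy => ?_) (Submodule.span_le.2 (Set.range_subset_iff.2 hwV))
    have hy' : L y ∈ Submodule.span ℝ (Set.range A) := hspan ▸ Submodule.mem_map_of_mem hy
    obtain ⟨c, hc⟩ := (Submodule.mem_span_range_iff_exists_fun ℝ).1 hy'
    have hdiff : y - ∑ i, c i • w i = 0 := by
      refine hinj _ (V.sub_mem hy (V.sum_mem fun i _ => V.smul_mem _ (hwV i))) fun i => ?_
      rw [← hL, map_sub, map_sum, ← hc]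
      simp [hw]
    rw [sub_eq_zero.1 hdiff]
    exact Submodule.sum_mem _ fun i _ =>
      Submodule.smul_mem _ _ (Submodule.subset_span ⟨i, rfl⟩)
  -- The signs come from moving bound variables and constants to the right-hand side.
  refine .inr ⟨r', k, A, Matrix.of fun i j => -(w i).1 (Fin.natAdd n j), fun i => -(w i).2, hA, h0,
    Der.congr_nus k ?_⟩
  refine (Der.system_of_span_eq hVw).trans (Der.trans (Der.of_eq ?_)
    (Der.conds_system _ _).symm)
  congr 1
  funext i
  have key := Aff.vec_sub_eq_of_eval (a := 1) (v := w i) (s := Aff.row A (Fin.castAdd k) i)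
    (t := .add (Aff.row (Matrix.of fun i j => -(w i).1 (Fin.natAdd n j)) (Fin.natAdd n) i)
      (.const (-(w i).2))) (fun x => by
        simp only [Aff.eval_row, Aff.eval_add, Aff.eval_const, Matrix.mulVec, dotProduct,
          Fin.sum_univ_add, one_mul, ← hw, hL, Matrix.of_apply, Function.comp_apply, neg_mul,
          Finset.sum_neg_distrib]
        ring)
  rw [one_smul] at key
  exact key.symm

theorem hasNormalForm_system (k : ℕ) : ∀ {r : ℕ} (v : Fin r → (Fin (n + k) → ℝ) × ℝ),
    HasNormalForm (nus k (system v)) := by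
  induction k with
  | zero => exact fun v => hasNormalForm_system_of_eliminate v fun j => j.elim0
  | succ k ih =>
    intro r v
    refine hasNormalForm_system_of_eliminate v fun _ w hw h0 h1 => ?_
    obtain ⟨v', hv'⟩ := exists_eliminate hw h0 h1
    exact .of_der hv' (ih v')

/-- Structural induction on the unprocessed part `u`, generalized over the `k` samplings and `r`
conditions already collected in front of it. The equations on `N` and `m` keep the indices of `Tm`
free for the induction. -/
theorem hasNormalForm_nus : ∀ {N m : ℕ} (u : Tm N m) (k : ℕ) (h : N = n + k) (hm : m = 0) (r : ℕ)
    (s t : Fin r → Aff N),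
    HasNormalForm (nus k (h ▸ hm ▸ conds r s t u : Tm (n + k) 0)) := by
  intro N m u
  induction u with
  | nu u ih =>
    rintro k rfl rfl r s t
    exact .of_der (Der.congr_nus k (Der.conds_nu r s t u))
      (ih (k + 1) rfl rfl r (fun i => (s i).wk) fun i => (t i).wk)
  | cond a b u ih =>
    rintro k rfl rfl r s t
    refine .of_der (Der.congr_nus k (Der.conds_cond r s t a b u))
      (ih k rfl rfl (r + 1) (Fin.cons a s) (Fin.cons b t))
  | ret t' =>
    rintro k rfl rfl r s t
    have h : Der (conds r s t (ret t')) (system fun i => (s i).vec - (t i).vec) :=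
      (Der.of_eq (by rw [ret_eq_done])).trans (Der.conds_system s t)
    exact .of_der (Der.congr_nus k h) (hasNormalForm_system k _)
  | bot =>
    rintro k rfl rfl r s t
    exact .inl ((Der.congr_nus k (Der.conds_bot r s t)).trans (Der.nus_bot k))

theorem hasNormalForm (u : Tm n 0) : HasNormalForm u :=
  hasNormalForm_nus u 0 rfl rfl 0 Fin.elim0 Fin.elim0

end ExactCond

namespace ExactCond

/-! ## Energies

The energy of a term is, up to scale and an additive constant, the negative logarithm of its
density: sampling minimizes over the bound variable, conditioning restricts the domain. -/

open Tm

section Energy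

open scoped ENNReal NNReal

/-- The energy of a computation at given inputs and outputs. -/
noncomputable def Tm.energy : {n m : ℕ} → Tm n m → (Fin n → ℝ) → (Fin m → ℝ) → ℝ≥0∞
  | _, _, .nu t, x, y => ⨅ z : ℝ, t.energy (Fin.snoc x z) y + ENNReal.ofReal (z ^ 2)
  | _, _, .cond s t u, x, y => ⨅ _ : s.eval x = t.eval x, u.energy x y
  | _, _, .ret t, x, y => ⨅ _ : (fun i => (t i).eval x) = y, 0
  | _, _, .bot, _, _ => ⊤

theorem Aff.eval_lift {n n' : ℕ} (σ : Fin n → Aff n') (x : Fin n' → ℝ) (z : ℝ) :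
    (fun i => (Aff.lift σ i).eval (Fin.snoc x z)) =
      (Fin.snoc (fun i => (σ i).eval x) z : Fin (n + 1) → ℝ) := by
  funext i
  refine Fin.lastCases ?_ (fun i => ?_) i <;> simp [Aff.lift]

theorem Tm.energy_subst : ∀ {n n' m : ℕ} (σ : Fin n → Aff n') (t : Tm n m) (x : Fin n' → ℝ)
    (y : Fin m → ℝ), (t.subst σ).energy x y = t.energy (fun i => (σ i).eval x) y
  | _, _, _, σ, nu t, x, y => by
    simp only [subst, energy, energy_subst (Aff.lift σ) t, Aff.eval_lift]
  | _, _, _, σ, cond s t u, x, y => by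
    simp only [subst, energy, energy_subst σ u, Aff.eval_subst]
  | _, _, _, σ, ret t, x, y => by simp only [subst, energy, Aff.eval_subst]
  | _, _, _, σ, bot, x, y => by simp only [subst, energy]

theorem Aff.eval_append {n m l : ℕ} (f : Fin n → Aff l) (g : Fin m → Aff l) (x : Fin l → ℝ) :
    (fun i => (Fin.append f g i).eval x) =
      Fin.append (fun i => (f i).eval x) fun i => (g i).eval x := by
  funext i
  induction i using Fin.addCases <;> simp

theorem Tm.energy_bind : ∀ {n m l : ℕ} (t : Tm n m) (u : Tm (n + m) l) (x : Fin n → ℝ)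
    (w : Fin l → ℝ), (t.bind u).energy x w = ⨅ y, t.energy x y + u.energy (Fin.append x y) w
  | n, m, _, nu t, u, x, w => by
    have h (y : Fin m → ℝ) (z : ℝ) : (fun i => (Fin.append
        (fun i : Fin n => Aff.var (Fin.castAdd m i.castSucc))
        (fun j : Fin m => Aff.var (Fin.natAdd (n + 1) j)) i).eval
          (Fin.append (Fin.snoc x z : Fin (n + 1) → ℝ) y)) = Fin.append x y := by
      rw [Aff.eval_append]
      simp
    simp only [bind, energy, energy_bind t, energy_subst, h, ENNReal.iInf_add]
    rw [iInf_comm]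
    exact iInf_congr fun _ => iInf_congr fun _ => add_right_comm _ _ _
  | _, _, _, cond s t v, u, x, w => by
    simp only [bind, energy, energy_bind v]
    by_cases h : s.eval x = t.eval x <;> simp [h]
  | _, _, _, ret t, u, x, w => by
    simp only [bind, energy, energy_subst, Aff.eval_append, Aff.eval_var]
    refine le_antisymm (le_iInf fun y => ?_) (iInf_le_of_le (fun i => (t i).eval x) (by simp))
    by_cases h : (fun i => (t i).eval x) = y
    · subst h; simp
    · simp [h]
  | _, _, _, bot, u, x, w => by simp [bind, energy]

theorem ofReal_sq_add {k : ℕ} (z : Fin k → ℝ) (a : ℝ) :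
    ENNReal.ofReal (a ^ 2) + ENNReal.ofReal (z ⬝ᵥ z) =
      ENNReal.ofReal ((Fin.snoc z a : Fin (k + 1) → ℝ) ⬝ᵥ Fin.snoc z a) := by
  have h : 0 ≤ z ⬝ᵥ z := Finset.sum_nonneg fun _ _ => mul_self_nonneg _
  rw [← ENNReal.ofReal_add (sq_nonneg _) h]
  simp only [dotProduct, Fin.sum_univ_castSucc, Fin.snoc_castSucc, Fin.snoc_last]
  rw [sq, add_comm]

theorem Tm.energy_nus {n m : ℕ} : ∀ (k : ℕ) (t : Tm (n + k) m) (x : Fin n → ℝ) (y : Fin m → ℝ),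
    (nus k t).energy x y =
      ⨅ z : Fin k → ℝ, t.energy (Fin.append x z) y + ENNReal.ofReal (z ⬝ᵥ z)
  | 0, t, x, y => by
    have h (z : Fin 0 → ℝ) : Fin.append x z = x := Fin.append_right_nil _ _ rfl
    simp [nus, h]
  | k + 1, t, x, y => by
    simp only [nus, energy_nus k, energy, ENNReal.iInf_add]
    refine le_antisymm (le_iInf fun z => ?_) (le_iInf fun z => le_iInf fun z' => ?_)
    · refine iInf_le_of_le (Fin.init z) (iInf_le_of_le (z (Fin.last k)) (le_of_eq ?_))
      rw [← Fin.append_snoc, add_assoc, ofReal_sq_add, Fin.snoc_init_self]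
    · refine iInf_le_of_le (Fin.snoc z z') (le_of_eq ?_)
      rw [← Fin.append_snoc, add_assoc, ofReal_sq_add]

/-- Equality of energies up to a finite additive constant. -/
def EnergyEq {n m : ℕ} (t u : Tm n m) : Prop :=
  ∃ a b : ℝ≥0, ∀ x y, t.energy x y + a = u.energy x y + b

theorem EnergyEq.of_eq {n m : ℕ} {t u : Tm n m} (h : ∀ x y, t.energy x y = u.energy x y) :
    EnergyEq t u := ⟨0, 0, fun x y => by rw [h]⟩

/-- Substituting `U z` for `z` is surjective and preserves the norm, so it only reindexes the
infimum. -/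
theorem energy_orth {n k : ℕ} {U : Matrix (Fin k) (Fin k) ℝ}
    (hU : U ∈ Matrix.orthogonalGroup (Fin k) ℝ) (x : Fin n → ℝ) (y : Fin k → ℝ) :
    (nus k (ret (Aff.row U (Fin.natAdd n)))).energy x y =
      (nus k (ret fun i => .var (Fin.natAdd n i))).energy x y := by
  have h1 : star U * U = 1 := (Matrix.mem_orthogonalGroup_iff' _ _).1 hU
  have h2 : U * star U = 1 := (Matrix.mem_orthogonalGroup_iff _ _).1 hU
  have hsurj : Function.Surjective (U *ᵥ ·) := fun z =>
    ⟨star U *ᵥ z, by simp [Matrix.mulVec_mulVec, h2]⟩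
  rw [energy_nus, energy_nus]
  refine hsurj.iInf_congr _ fun z => ?_
  have h3 : (U *ᵥ z) ⬝ᵥ (U *ᵥ z) = z ⬝ᵥ z := by
    rw [Matrix.dotProduct_mulVec, Matrix.vecMul_mulVec, ← Matrix.dotProduct_mulVec]
    rw [Matrix.star_eq_conjTranspose, Matrix.conjTranspose_eq_transpose_of_trivial] at h1
    rw [h1, Matrix.one_mulVec]
  have h4 : Fin.append x z ∘ Fin.natAdd n = z := by funext i; simp
  have h5 : (fun i => (Aff.row U (Fin.natAdd n) i).eval (Fin.append x z)) = U *ᵥ z := by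
    funext i; rw [Aff.eval_row, h4]
  simp only [energy, h3, h5, Aff.eval_var, Fin.append_right]

/-- Derivable equality is sound for energies. -/
theorem Der.energyEq {n m : ℕ} {t u : Tm n m} (h : Der t u) : EnergyEq t u := by
  induction h with
  | refl t => exact .of_eq fun _ _ => rfl
  | symm _ ih =>
    obtain ⟨a, b, h⟩ := ih
    exact ⟨b, a, fun x y => (h x y).symm⟩
  | trans _ _ ih ih' =>
    obtain ⟨a, b, h⟩ := ih
    obtain ⟨c, d, h'⟩ := ih'
    refine ⟨a + c, d + b, fun x y => ?_⟩
    rw [ENNReal.coe_add, ← add_assoc, h, add_right_comm, h', ENNReal.coe_add, add_assoc]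
  | congr_nu _ ih =>
    obtain ⟨a, b, h⟩ := ih
    refine ⟨a, b, fun x y => ?_⟩
    simp only [energy, ENNReal.iInf_add]
    exact iInf_congr fun z => by rw [add_right_comm, h, add_right_comm]
  | @congr_cond n m s s' t t' u u' hs ht _ ih =>
    obtain ⟨a, b, h⟩ := ih
    refine ⟨a, b, fun x y => ?_⟩
    simp only [energy, hs.eval_eq x fun _ _ h => h.elim, ht.eval_eq x fun _ _ h => h.elim]
    by_cases hst : s'.eval x = t'.eval x <;> simp [hst, h]
  | congr_ret h =>
    refine .of_eq fun x y => ?_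
    simp only [energy, fun i => (h i).eval_eq x fun _ _ h => h.elim]
  | subst σ _ ih =>
    obtain ⟨a, b, h⟩ := ih
    exact ⟨a, b, fun x y => by rw [energy_subst, energy_subst, h]⟩
  | bind _ _ ih ih' =>
    obtain ⟨a, b, h⟩ := ih
    obtain ⟨c, d, h'⟩ := ih'
    refine ⟨a + c, b + d, fun x y => ?_⟩
    simp only [energy_bind, ENNReal.iInf_add, ENNReal.coe_add]
    exact iInf_congr fun z => by rw [add_add_add_comm, h, h', add_add_add_comm]
  | disc =>
    refine .of_eq fun x y => ?_
    simp only [done, energy, Subsingleton.elim _ y, iInf_pos, zero_add]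
    exact le_antisymm (iInf_le_of_le 0 (by simp)) bot_le
  | orth U hU => exact .of_eq fun x y => energy_orth hU x y
  | cond_comm a b c d => exact .of_eq fun x y => by simp only [energy]; rw [iInf_comm]
  | nu_comm_cond a b =>
    refine .of_eq fun x y => ?_
    simp only [energy, Aff.eval_subst, Aff.eval_var, Fin.snoc_castSucc]
    by_cases h : a.eval x = b.eval x <;> simp [h]
  | cond_bot a b => exact .of_eq fun x y => by simp [energy]
  | taut a => exact .of_eq fun x y => by simp [energy]
  | fail => exact .of_eq fun x y => by simp [energy]
  | subs a b =>
    refine .of_eq fun x y => ?_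
    simp only [energy]
    exact iInf_congr fun h => by rw [h]
  | init c =>
    -- INIT forgets the density of the normal distribution at `c`; this is why energies are compared
    -- only up to a constant.
    refine ⟨0, (c ^ 2).toNNReal, fun x y => ?_⟩
    have hc : ((c ^ 2).toNNReal : ℝ≥0∞) = ENNReal.ofReal (c ^ 2) := rfl
    simp only [energy, Aff.eval_var, Aff.eval_const, Fin.snoc_last, hc, ENNReal.coe_zero, add_zero]
    refine le_antisymm (iInf_le_of_le c (by simp)) (le_iInf fun z => ?_)
    by_cases h : z = c
    · subst h; simp
    · simp [h]
  | cong h =>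
    refine .of_eq fun x y => ?_
    have he := propext (Iff.intro
      (fun he => h.1.eval_eq x (by rintro _ _ ⟨rfl, rfl⟩; exact he))
      (fun he => h.2.eval_eq x (by rintro _ _ ⟨rfl, rfl⟩; exact he)))
    simp only [energy, he]

theorem energy_conds_done {n : ℕ} : ∀ (r : ℕ) (s t : Fin r → Aff n) (x : Fin n → ℝ)
    (y : Fin 0 → ℝ), (conds r s t done).energy x y = ⨅ _ : ∀ i, (s i).eval x = (t i).eval x, 0
  | 0, s, t, x, y => by simp [conds, done, energy, Subsingleton.elim _ y]
  | r + 1, s, t, x, y => by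
    simp only [conds, energy, energy_conds_done r, Fin.forall_fin_succ]
    rw [iInf_and]

end Energy

end ExactCond

namespace ExactCond

/-! ## Uniqueness of normal forms up to derivable equality -/

open Tm

/-! ### Convex duality for the energy of a soft constraint -/

section SoftEnergy

variable {n r k : ℕ} (A : Matrix (Fin r) (Fin n) ℝ) (B : Matrix (Fin r) (Fin k) ℝ) (c : Fin r → ℝ)

theorem energy_soft (x : Fin n → ℝ) (y : Fin 0 → ℝ) : (soft A B c).energy x y =
    ⨅ z : Fin k → ℝ, ⨅ _ : A *ᵥ x = B *ᵥ z + c, ENNReal.ofReal (z ⬝ᵥ z) := by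
  rw [soft, energy_nus]
  refine iInf_congr fun z => ?_
  have h1 : Fin.append x z ∘ Fin.natAdd n = z := by funext i; simp
  have h2 : Fin.append x z ∘ Fin.castAdd k = x := by funext i; simp
  simp only [energy_conds_done, Aff.eval_row, Aff.eval_add, Aff.eval_const, h1, h2]
  have h3 : (∀ i, (A *ᵥ x) i = (B *ᵥ z) i + c i) ↔ A *ᵥ x = B *ᵥ z + c := by
    rw [funext_iff]; rfl
  simp only [h3]
  by_cases h : A *ᵥ x = B *ᵥ z + c <;> simp [h]

theorem energy_soft_le {x : Fin n → ℝ} {z : Fin k → ℝ} (h : A *ᵥ x = B *ᵥ z + c)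
    (y : Fin 0 → ℝ) : (soft A B c).energy x y ≤ ENNReal.ofReal (z ⬝ᵥ z) := by
  rw [energy_soft]
  exact iInf_le_of_le z (iInf_le _ h)

/-- Weak duality: if `A x - c = B z`, then the pairing with `ξ` is `(ξ B) · z`, at most `|z|² + |ξ
B|² / 4` by completing the square. Equality holds at `z = ξ B / 2`. -/
theorem le_energy_soft (x : Fin n → ℝ) (y : Fin 0 → ℝ) (ξ : Fin r → ℝ) :
    ENNReal.ofReal (ξ ⬝ᵥ (A *ᵥ x - c) - (ξ ᵥ* B) ⬝ᵥ (ξ ᵥ* B) / 4) ≤ (soft A B c).energy x y := by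
  rw [energy_soft]
  refine le_iInf fun z => le_iInf fun h => ENNReal.ofReal_le_ofReal ?_
  rw [h, add_sub_cancel_right, Matrix.dotProduct_mulVec]
  simp only [dotProduct, Finset.sum_div, ← Finset.sum_sub_distrib]
  exact Finset.sum_le_sum fun i _ => by nlinarith [sq_nonneg ((ξ ᵥ* B) i - 2 * z i)]

theorem energy_soft_eq_zero_iff (x : Fin n → ℝ) (y : Fin 0 → ℝ) :
    (soft A B c).energy x y = 0 ↔ A *ᵥ x = c := by
  constructor
  · intro h
    set w := A *ᵥ x - c with hw
    set K := (w ᵥ* B) ⬝ᵥ (w ᵥ* B) with hK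
    have hK0 : 0 ≤ K := Finset.sum_nonneg fun _ _ => mul_self_nonneg _
    -- Duality at `ξ = a w`: a linear function of `a` is bounded by a quadratic one without linear
    -- term, so its slope `|w|²` is zero.
    have h1 (a : ℝ) : a * (w ⬝ᵥ w) ≤ a * a * K / 4 := by
      have h2 := le_energy_soft A B c x y (a • w)
      rw [h, nonpos_iff_eq_zero, ENNReal.ofReal_eq_zero, ← hw] at h2
      simp only [Matrix.smul_vecMul, smul_dotProduct, dotProduct_smul, smul_eq_mul, ← hK] at h2
      linarith
    have h3 : w ⬝ᵥ w = 0 := by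
      have hp : 0 < K + 1 := by linarith
      -- The denominator `K + 1` stays positive when `K = 0`.
      have h6 := h1 (2 * (w ⬝ᵥ w) / (K + 1))
      have h7 : 2 * (w ⬝ᵥ w) ^ 2 * (K + 1) ≤ (w ⬝ᵥ w) ^ 2 * K := by
        have := mul_le_mul_of_nonneg_left h6 (mul_self_nonneg (K + 1))
        field_simp at this
        linarith
      nlinarith [sq_nonneg (w ⬝ᵥ w)]
    exact sub_eq_zero.1 (dotProduct_self_eq_zero.1 h3)
  · intro h
    refine le_antisymm ((energy_soft_le A B c (z := 0) (by simp [h]) y).trans ?_) bot_le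
    simp

end SoftEnergy

/-- Polarization on the standard basis. -/
theorem eq_of_dotProduct_mulVec_eq {r : ℕ} {S T : Matrix (Fin r) (Fin r) ℝ}
    (hS : Sᵀ = S) (hT : Tᵀ = T) (h : ∀ ξ, ξ ⬝ᵥ (S *ᵥ ξ) = ξ ⬝ᵥ (T *ᵥ ξ)) : S = T := by
  have hs (M : Matrix (Fin r) (Fin r) ℝ) (i j) :
      Pi.single i 1 ⬝ᵥ (M *ᵥ Pi.single j 1) = M i j := by simp
  ext i j
  have h1 := h (Pi.single i 1 + Pi.single j 1)
  simp only [Matrix.mulVec_add, dotProduct_add, add_dotProduct, hs] at h1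
  have h2 := h (Pi.single i 1)
  have h3 := h (Pi.single j 1)
  rw [hs, hs] at h2 h3
  have h4 : S j i = S i j := congrFun (congrFun hS i) j
  have h5 : T j i = T i j := congrFun (congrFun hT i) j
  linarith

section Uniqueness

variable {n r r' k k' : ℕ} {A : Matrix (Fin r) (Fin n) ℝ} {B : Matrix (Fin r) (Fin k) ℝ}
  {c : Fin r → ℝ} {A' : Matrix (Fin r') (Fin n) ℝ} {B' : Matrix (Fin r') (Fin k') ℝ}
  {c' : Fin r' → ℝ}

theorem exists_mulVec_eq (hA : IsRREF A) (h0 : ∀ i, A i ≠ 0) (w : Fin r → ℝ) :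
    ∃ x, A *ᵥ x = w := by
  obtain ⟨R, hR⟩ := hA.exists_rightInverse h0
  exact ⟨R *ᵥ w, by rw [Matrix.mulVec_mulVec, hR, Matrix.one_mulVec]⟩

/-- With `A R = 1`, each `v - R A v` lies in the kernel of `A`, so `A'` factors as `A' R A`. -/
theorem span_rows_le_of_ker_le (hA : IsRREF A) (h0 : ∀ i, A i ≠ 0)
    (h : ∀ x, A *ᵥ x = 0 → A' *ᵥ x = 0) :
    Submodule.span ℝ (Set.range A') ≤ Submodule.span ℝ (Set.range A) := by
  obtain ⟨R, hR⟩ := hA.exists_rightInverse h0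
  have h1 : A' = A' * R * A := by
    refine Matrix.ext_of_mulVec_single fun j => ?_
    have h2 := h (Pi.single j 1 - R *ᵥ (A *ᵥ Pi.single j 1)) (by
      rw [Matrix.mulVec_sub, Matrix.mulVec_mulVec, hR, Matrix.one_mulVec, sub_self])
    rw [Matrix.mulVec_sub, sub_eq_zero] at h2
    rw [h2, Matrix.mulVec_mulVec, Matrix.mulVec_mulVec]
  rw [h1]
  exact span_rows_mul_le _ _

/-- The sample `z = ξ B / 2`, optimal for `B`, gives energy at most `|ξ B|² / 4`, while duality for
`B'` at the same point gives at least `|ξ B|² / 2 - |ξ B'|² / 4`. -/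
theorem gram_le_of_energy_eq {A : Matrix (Fin r) (Fin n) ℝ} {B' : Matrix (Fin r) (Fin k') ℝ}
    (hA : IsRREF A) (h0 : ∀ i, A i ≠ 0)
    (h : ∀ x y, (soft A B c).energy x y = (soft A B' c).energy x y) (ξ : Fin r → ℝ) :
    (ξ ᵥ* B) ⬝ᵥ (ξ ᵥ* B) ≤ (ξ ᵥ* B') ⬝ᵥ (ξ ᵥ* B') := by
  obtain ⟨x, hx⟩ := exists_mulVec_eq hA h0 (B *ᵥ ((1 / 2 : ℝ) • (ξ ᵥ* B)) + c)
  have h1 := (le_energy_soft A B' c x 0 ξ).trans ((h x 0).symm.le.trans (energy_soft_le A B c hx 0))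
  have hK : 0 ≤ (ξ ᵥ* B) ⬝ᵥ (ξ ᵥ* B) := Finset.sum_nonneg fun _ _ => mul_self_nonneg _
  rw [hx, add_sub_cancel_right, Matrix.dotProduct_mulVec] at h1
  simp only [smul_dotProduct, dotProduct_smul, smul_eq_mul] at h1
  rw [ENNReal.ofReal_le_ofReal_iff (by positivity)] at h1
  linarith

theorem sameData_of_energyEq (hA : IsRREF A) (h0 : ∀ i, A i ≠ 0) (hA' : IsRREF A')
    (h0' : ∀ i, A' i ≠ 0) (h : EnergyEq (soft A B c) (soft A' B' c')) :
    SameData A B c A' B' c' := by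
  obtain ⟨a, b, h⟩ := h
  obtain ⟨x, hx⟩ := exists_mulVec_eq hA h0 c
  obtain ⟨x', hx'⟩ := exists_mulVec_eq hA' h0' c'
  -- Both energies attain the value `0`, so neither additive constant can exceed the other.
  have hab : a = b := by
    have h1 := h x 0
    have h2 := h x' 0
    rw [(energy_soft_eq_zero_iff A B c x 0).2 hx, zero_add] at h1
    rw [(energy_soft_eq_zero_iff A' B' c' x' 0).2 hx', zero_add] at h2
    refine le_antisymm ?_ ?_
    · exact ENNReal.coe_le_coe.1 (h2 ▸ le_add_self)
    · exact ENNReal.coe_le_coe.1 (h1 ▸ le_add_self)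
  subst hab
  have he (x y) : (soft A B c).energy x y = (soft A' B' c').energy x y :=
    (ENNReal.add_left_inj ENNReal.coe_ne_top).1 (h x y)
  have hz (x) : A *ᵥ x = c ↔ A' *ᵥ x = c' := by
    rw [← energy_soft_eq_zero_iff A B c x 0, he, energy_soft_eq_zero_iff]
  have hx2 := (hz x).1 hx
  have hker (v) : A *ᵥ v = 0 ↔ A' *ᵥ v = 0 := by
    have := hz (x + v)
    rwa [Matrix.mulVec_add, Matrix.mulVec_add, hx, hx2, add_eq_left, add_eq_left] at this
  obtain ⟨e, hAA⟩ := hA.eq_of_span_eq h0 hA' h0' (le_antisymm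
    (span_rows_le_of_ker_le hA' h0' fun v => (hker v).2)
    (span_rows_le_of_ker_le hA h0 fun v => (hker v).1))
  subst e
  simp only [Fin.cast_refl, Matrix.submatrix_id_id] at hAA
  subst hAA
  have hcc : c = c' := hx.symm.trans hx2
  subst hcc
  refine ⟨rfl, rfl, rfl, eq_of_dotProduct_mulVec_eq (by simp) (by simp) fun ξ => ?_⟩
  have h3 := le_antisymm (gram_le_of_energy_eq hA h0 he ξ)
    (gram_le_of_energy_eq hA h0 (fun x y => (he x y).symm) ξ)
  simpa [← Matrix.mulVec_mulVec, Matrix.dotProduct_mulVec, Matrix.mulVec_transpose] using h3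

theorem not_energyEq_bot (hA : IsRREF A) (h0 : ∀ i, A i ≠ 0) :
    ¬ EnergyEq (soft A B c) .bot := by
  rintro ⟨a, b, h⟩
  obtain ⟨x, hx⟩ := exists_mulVec_eq hA h0 c
  have h1 := h x 0
  rw [(energy_soft_eq_zero_iff A B c x 0).2 hx, zero_add] at h1
  simp [energy] at h1

end Uniqueness

end ExactCond

namespace ExactCond

/-! ## Denotations of soft constraints -/

namespace GaussHom

variable {X Y Z W : Type} [Fintype X] [Fintype Y] [Fintype Z] [Fintype W]

theorem comp_A (g : GaussHom Y Z) (f : GaussHom X Y) : (g.comp f).A = g.A * f.A := rfl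
theorem comp_b (g : GaussHom Y Z) (f : GaussHom X Y) : (g.comp f).b = g.A *ᵥ f.b + g.b := rfl
theorem comp_S (g : GaussHom Y Z) (f : GaussHom X Y) :
    (g.comp f).S = g.A * f.S * g.Aᵀ + g.S := rfl

section Pair

variable [DecidableEq X] (f : GaussHom X Y) (g : GaussHom X Z)

theorem pair_A : (pair f g).A = Matrix.fromRows f.A g.A := by
  have h : (wire (Sum.elim id id : X ⊕ X → X)).A = Matrix.fromRows 1 1 := by
    ext (i | i) j <;> rfl
  rw [pair, comp_A, h, tensor, Matrix.fromBlocks_mul_fromRows]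
  simp

theorem pair_b : (pair f g).b = Sum.elim f.b g.b := by
  simp [pair, comp, tensor, wire, det]

theorem pair_S : (pair f g).S = Matrix.fromBlocks f.S 0 0 g.S := by
  simp [pair, comp, tensor, wire, det]

end Pair

section Wire

variable [DecidableEq Y] (e : Z → Y) (f : GaussHom X Y)

theorem wire_comp_A : ((wire e).comp f).A = f.A.submatrix e id := by
  ext i j
  simp [comp, wire, det, Matrix.mul_apply, Matrix.one_apply]

theorem wire_comp_b : ((wire e).comp f).b = f.b ∘ e := by
  ext i
  simp [comp, wire, det, Matrix.mulVec, dotProduct, Matrix.one_apply]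

theorem wire_comp_S : ((wire e).comp f).S = f.S.submatrix e e := by
  ext i j
  simp [comp, wire, det, Matrix.mul_apply, Matrix.one_apply]

theorem wire_id : wire (id : Y → Y) = ⟨1, 0, 0, Matrix.PosSemidef.zero⟩ := rfl

end Wire

/-- Almost sure equality for a nondegenerate state is equality. -/
theorem AsEq.eq_of_isUnit [DecidableEq X] {ν : GaussHom (Fin 0) X} (hν : IsUnit ν.S)
    {f g : GaussHom X Y} (h : AsEq ν f g) : f = g := by
  have hS := congrArg GaussHom.S h
  have hb := congrArg GaussHom.b h
  simp only [comp, pair_A, pair_b, pair_S, wire_id, Matrix.transpose_fromRows,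
    Matrix.fromRows_mul, Matrix.mul_fromCols, Matrix.fromRows_mulVec] at hS hb
  have hA : f.A = g.A := by
    have h1 : f.A * ν.S = g.A * ν.S := by
      ext i j
      simpa using congrFun (congrFun hS (.inr i)) (.inl j)
    have hd := (Matrix.isUnit_iff_isUnit_det _).1 hν
    rw [← Matrix.mul_nonsing_inv_cancel_right _ f.A hd, h1, Matrix.mul_nonsing_inv_cancel_right _ _ hd]
  refine GaussHom.ext hA ?_ ?_
  · ext i
    simpa [hA] using congrFun hb (.inr i)
  · ext i j
    simpa [hA] using congrFun (congrFun hS (.inr i)) (.inr j)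

theorem absCont_of_isUnit [DecidableEq X] (μ : GaussHom (Fin 0) X) {ν : GaussHom (Fin 0) X}
    (hν : IsUnit ν.S) : AbsCont μ ν := fun _ _ _ h => by
  rw [h.eq_of_isUnit hν]; rfl

/-- For the point mass `ν`, the coordinate `i` is almost surely the constant `ν.b i`; under `μ` the
means differ. -/
theorem not_absCont_of_ne [DecidableEq X] {μ ν : GaussHom (Fin 0) X} (hν : ν.S = 0) {i : X}
    (h : μ.b i ≠ ν.b i) : ¬ AbsCont μ ν := by
  intro hac
  have h1 := hac 1 (wire fun _ => i) (det 0 fun _ => ν.b i) (by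
    refine GaussHom.ext ?_ ?_ ?_
    · ext _ j; exact j.elim0
    · ext (j | j)
      · simp [comp, pair_A, pair_b, wire_id, Matrix.fromRows_mulVec]
      · simp [comp, pair_A, pair_b, Matrix.fromRows_mulVec, wire, det, Matrix.mulVec, dotProduct,
          Matrix.one_apply]
    · ext (j | j) (l | l) <;> simp [comp, pair_S, hν, wire, det])
  have h2 := congrFun (congrArg GaussHom.b h1) (.inr 0)
  simp [comp, pair_A, pair_b, Matrix.fromRows_mulVec, wire, det, Matrix.mulVec, dotProduct,
    Matrix.one_apply] at h2
  exact h h2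

/-- Blockwise comparison of means and covariances; the second identity is the normal equation for
the regression matrix `κ.A`. -/
theorem IsConditional.eqs [DecidableEq X] [DecidableEq Y] {ψ : GaussHom (Fin 0) (X ⊕ Y)}
    {κ : GaussHom Y X} (h : IsConditional ψ κ) :
    (∀ i, ∑ k, κ.A i k * ψ.b (.inr k) + κ.b i = ψ.b (.inl i)) ∧
    (∀ i k, ∑ l, κ.A i l * ψ.S (.inr l) (.inr k) = ψ.S (.inl i) (.inr k)) ∧
    ∀ i j, ∑ k, ψ.S (.inl i) (.inr k) * κ.A j k + κ.S i j = ψ.S (.inl i) (.inl j) := by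
  have hS := congrArg GaussHom.S h
  have hb := congrArg GaussHom.b h
  rw [comp_S, pair_A, pair_S, marg, wire_comp_S] at hS
  rw [comp_b, pair_A, pair_b, marg, wire_comp_b] at hb
  simp only [wire_id, Matrix.transpose_fromRows,
    Matrix.fromRows_mul, Matrix.mul_fromCols, Matrix.fromRows_mulVec] at hS hb
  have h1 (i k) : ∑ l, κ.A i l * ψ.S (.inr l) (.inr k) = ψ.S (.inl i) (.inr k) := by
    simpa [Matrix.mul_apply] using congrFun (congrFun hS (.inl i)) (.inr k)
  refine ⟨fun i => ?_, h1, fun i j => ?_⟩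
  · simpa [Matrix.mulVec, dotProduct] using congrFun hb (.inl i)
  · simpa [Matrix.mul_apply, h1] using congrFun (congrFun hS (.inl i)) (.inl j)

/-- A standard normal vector together with a copy. -/
noncomputable def stdCopy (n : ℕ) : GaussHom (Fin 0) (Fin n ⊕ Fin n) :=
  (wire (Sum.elim id id)).comp ⟨0, 0, 1, Matrix.PosSemidef.one⟩

theorem stdCopy_b (n : ℕ) : (stdCopy n).b = 0 := by
  simp [stdCopy, wire_comp_b]

theorem stdCopy_S (n : ℕ) : (stdCopy n).S = Matrix.fromBlocks 1 1 1 1 := by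
  rw [stdCopy, wire_comp_S]
  ext (i | i) (j | j) <;> rfl

end GaussHom

open GaussHom

/-! ### Soft constraints as linear Gaussian observations -/

section Models

variable {n r : ℕ}

/-- Up to relabelling, `φ` observes the value `0` of `M x + d + N(0, S)`. -/
def ObsHom.Models (φ : ObsHom (Fin n) (Fin 0)) (M : Matrix (Fin r) (Fin n) ℝ) (d : Fin r → ℝ)
    (S : Matrix (Fin r) (Fin r) ℝ) : Prop :=
  ∃ e : φ.K ≃ Fin r, (∀ k j, φ.f.A (.inr k) j = M (e k) j) ∧ (∀ k, φ.f.b (.inr k) = d (e k)) ∧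
    (∀ k l, φ.f.S (.inr k) (.inr l) = S (e k) (e l)) ∧ ∀ k, φ.o k = 0

/-- Relabelling of an additional observation as the first one. -/
def consEquiv {K : Type} (e : K ≃ Fin r) : K ⊕ Unit ≃ Fin (r + 1) where
  toFun := Sum.elim (fun k => (e k).succ) fun _ => 0
  invFun := Fin.cases (.inr ()) fun i => .inl (e.symm i)
  left_inv := by rintro (k | _) <;> simp
  right_inv i := by induction i using Fin.cases <;> simp

theorem ObsHom.Models.congr {φ : ObsHom (Fin n) (Fin 0)} {M M' : Matrix (Fin r) (Fin n) ℝ}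
    {d d' : Fin r → ℝ} {S S' : Matrix (Fin r) (Fin r) ℝ} (h : φ.Models M d S)
    (hM : ∀ i j, M i j = M' i j) (hd : ∀ i, d i = d' i) (hS : ∀ i j, S i j = S' i j) :
    φ.Models M' d' S' := by
  rwa [← Matrix.ext hM, ← funext hd, ← Matrix.ext hS]

theorem models_conds : ∀ (r : ℕ) (s t : Fin r → Aff n), (Tm.conds r s t Tm.done).den.Models
    (Matrix.of fun i j => (s i).coeff j - (t i).coeff j) (fun i => (s i).offset - (t i).offset) 0
  | 0, s, t => ⟨Equiv.refl (Fin 0), fun k => k.elim0, fun k => k.elim0, fun k => k.elim0,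
      fun k => k.elim0⟩
  | r + 1, s, t => by
    obtain ⟨e, hA, hb, hS, ho⟩ := models_conds r (fun i => s i.succ) fun i => t i.succ
    refine ⟨consEquiv e, ?_, ?_, ?_, ?_⟩
    all_goals simp only [Tm.conds, Tm.den]
    · rintro (k | k) j <;> rw [wire_comp_A, pair_A]
      · exact hA k j
      · change (s 0).coeff j + -1 * (t 0).coeff j = (s 0).coeff j - (t 0).coeff j
        ring
    · rintro (k | k) <;> rw [wire_comp_b, pair_b]
      · exact hb k
      · change (s 0).offset + -1 * (t 0).offset = (s 0).offset - (t 0).offset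
        ring
    · rintro (k | k) (l | l) <;> rw [wire_comp_S, pair_S]
      · exact hS k l
      all_goals rfl
    · rintro (k | k)
      · exact ho k
      · rfl

theorem GaussHom.fresh_A (i : Fin (n + 1)) (j : Fin n) :
    (fresh n).A i j = if i = j.castSucc then 1 else 0 := by
  rw [fresh, wire_comp_A, pair_A]
  induction i using Fin.lastCases with
  | last => simp [normal, (Fin.castSucc_lt_last j).ne']
  | cast i => simp [wire_id, Matrix.one_apply]

theorem GaussHom.fresh_b : (fresh n).b = 0 := by
  rw [fresh, wire_comp_b, pair_b]
  ext i
  induction i using Fin.lastCases <;> simp [normal, wire_id]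

theorem GaussHom.fresh_S (i j : Fin (n + 1)) :
    (fresh n).S i j = if i = Fin.last n ∧ j = Fin.last n then 1 else 0 := by
  rw [fresh, wire_comp_S, pair_S]
  induction i using Fin.lastCases <;> induction j using Fin.lastCases <;>
    simp [normal, wire_id, Fin.castSucc_ne_last]

/-- Sampling the last variable turns its column of coefficients into a rank-one noise covariance. -/
theorem models_nu {t : Tm (n + 1) 0} {M : Matrix (Fin r) (Fin (n + 1)) ℝ} {d : Fin r → ℝ}
    {S : Matrix (Fin r) (Fin r) ℝ} (h : t.den.Models M d S) :
    (Tm.nu t).den.Models (M.submatrix id Fin.castSucc) d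
      (S + Matrix.of fun i j => M i (Fin.last n) * M j (Fin.last n)) := by
  obtain ⟨e, hA, hb, hS, ho⟩ := h
  refine ⟨e, ?_, ?_, ?_, ho⟩
  all_goals simp only [Tm.den]
  · intro k j
    simp [comp_A, Matrix.mul_apply, fresh_A, hA]
    rfl
  · intro k
    simp [comp_b, fresh_b, hb]
    rfl
  · intro k l
    simp [comp_S, Matrix.mul_apply, fresh_S, hS, hA, ite_and, add_comm]
    rfl

theorem models_nus : ∀ (k : ℕ) {t : Tm (n + k) 0} {M : Matrix (Fin r) (Fin (n + k)) ℝ}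
    {d : Fin r → ℝ} {S : Matrix (Fin r) (Fin r) ℝ}, t.den.Models M d S →
    (Tm.nus k t).den.Models (M.submatrix id (Fin.castAdd k)) d
      (S + M.submatrix id (Fin.natAdd n) * (M.submatrix id (Fin.natAdd n))ᵀ)
  | 0, t, M, d, S, h => by
    have e : S + M.submatrix id (Fin.natAdd n) * (M.submatrix id (Fin.natAdd n))ᵀ = S := by
      ext i j
      simp
    rw [e]
    exact h
  | k + 1, t, M, d, S, h => by
    have h1 := models_nus k (models_nu h)
    have h2 (i j) : (S + M.submatrix id (Fin.natAdd n) * (M.submatrix id (Fin.natAdd n))ᵀ) i j =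
        (S + Matrix.of (fun i j => M i (Fin.last (n + k)) * M j (Fin.last (n + k))) +
          (M.submatrix id Fin.castSucc).submatrix id (Fin.natAdd n) *
          ((M.submatrix id Fin.castSucc).submatrix id (Fin.natAdd n))ᵀ) i j := by
      simp only [Matrix.add_apply, Matrix.mul_apply, Matrix.submatrix_apply,
        Matrix.transpose_apply, Matrix.of_apply, Fin.sum_univ_castSucc, id]
      rw [add_assoc, add_comm (M i (Fin.last (n + k)) * _)]
      rfl
    rw [Matrix.ext h2]
    exact h1

theorem coeff_row {m r k : ℕ} (M : Matrix (Fin r) (Fin k) ℝ) (v : Fin k → Fin m) (i : Fin r)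
    (j : Fin m) : (Aff.row M v i).coeff j = ∑ l, if v l = j then M i l else 0 := by
  change (Aff.row M v i).vec.1 j = _
  simp [Aff.row, Aff.vec_sum, Prod.fst_sum, Pi.single_apply, eq_comm]

theorem offset_row {m r k : ℕ} (M : Matrix (Fin r) (Fin k) ℝ) (v : Fin k → Fin m) (i : Fin r) :
    (Aff.row M v i).offset = 0 := by
  change (Aff.row M v i).vec.2 = _
  simp [Aff.row, Aff.vec_sum, Prod.snd_sum]

/-- A soft constraint observes the value `0` of `A x - c + N(0, B Bᵀ)`. -/
theorem models_soft {k : ℕ} (A : Matrix (Fin r) (Fin n) ℝ) (B : Matrix (Fin r) (Fin k) ℝ)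
    (c : Fin r → ℝ) : (Tm.soft A B c).den.Models A (-c) (B * Bᵀ) := by
  have h := models_nus k (models_conds r (Aff.row A (Fin.castAdd k))
    (fun i => .add (Aff.row B (Fin.natAdd n) i) (.const (c i))))
  have hne (i : Fin n) (j : Fin k) : Fin.castAdd k i ≠ Fin.natAdd n j := by
    intro h; have := congrArg Fin.val h; simp at this; omega
  refine h.congr (fun i j => ?_) (fun i => ?_) fun i j => ?_
  · simp [coeff_row, Aff.coeff, (hne _ _).symm]
  · simp [offset_row, Aff.offset]
  · simp [coeff_row, Aff.coeff, hne, Matrix.mul_apply]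

end Models

end ExactCond

namespace ExactCond

/-! ## Uniqueness of normal forms up to equality of denotations -/

open GaussHom

/-! ### The posterior of a standard normal input -/

section Posterior

variable {n r : ℕ}

theorem tensor_stdCopy_b {Y : Type} [Fintype Y] (f : GaussHom (Fin n) Y) :
    ((tensor (wire id) f).comp (stdCopy n)).b = Sum.elim (0 : Fin n → ℝ) f.b := by
  rw [comp_b, stdCopy_b, Matrix.mulVec_zero, zero_add]
  rfl

theorem tensor_stdCopy_S {Y : Type} [Fintype Y] (f : GaussHom (Fin n) Y) :
    ((tensor (wire id) f).comp (stdCopy n)).S =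
      Matrix.fromBlocks 1 f.Aᵀ f.A (f.A * f.Aᵀ + f.S) := by
  simp [comp_S, stdCopy_S, tensor, wire_id, Matrix.fromBlocks_multiply,
    Matrix.fromBlocks_transpose, Matrix.fromBlocks_add]

variable (φ : ObsHom (Fin n) (Fin 0))

theorem apply_stdCopy_b_inl (i : Fin n) : (φ.apply (stdCopy n)).f.b (.inl (.inl i)) = 0 := by
  simp only [ObsHom.apply, wire_comp_b, tensor_stdCopy_b]; rfl

theorem apply_stdCopy_b_inr (k : φ.K) :
    (φ.apply (stdCopy n)).f.b (.inr k) = φ.f.b (.inr k) := by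
  simp only [ObsHom.apply, wire_comp_b, tensor_stdCopy_b]; rfl

theorem apply_stdCopy_S_inl_inl (i j : Fin n) : (φ.apply (stdCopy n)).f.S (.inl (.inl i))
    (.inl (.inl j)) = (1 : Matrix (Fin n) (Fin n) ℝ) i j := by
  simp only [ObsHom.apply, wire_comp_S, tensor_stdCopy_S]; rfl

theorem apply_stdCopy_S_inl_inr (i : Fin n) (k : φ.K) :
    (φ.apply (stdCopy n)).f.S (.inl (.inl i)) (.inr k) = φ.f.A (.inr k) i := by
  simp only [ObsHom.apply, wire_comp_S, tensor_stdCopy_S]; rfl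

theorem apply_stdCopy_S_inr_inr (k l : φ.K) : (φ.apply (stdCopy n)).f.S (.inr k) (.inr l) =
    ∑ j, φ.f.A (.inr k) j * φ.f.A (.inr l) j + φ.f.S (.inr k) (.inr l) := by
  simp only [ObsHom.apply, wire_comp_S, tensor_stdCopy_S]; rfl

variable {φ} {A : Matrix (Fin r) (Fin n) ℝ} {c : Fin r → ℝ} {Q : Matrix (Fin r) (Fin r) ℝ}

theorem apply_stdCopy_S_inr_inr_eq (e : φ.K ≃ Fin r) (hA : ∀ k j, φ.f.A (.inr k) j = A (e k) j)
    (hS : ∀ k l, φ.f.S (.inr k) (.inr l) = Q (e k) (e l)) (k l : φ.K) :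
    (φ.apply (stdCopy n)).f.S (.inr k) (.inr l) = (A * Aᵀ + Q) (e k) (e l) := by
  rw [apply_stdCopy_S_inr_inr]
  simp only [hA, hS]
  rfl

theorem ObsHom.Models.succeeds (h : φ.Models A (-c) Q) (hu : IsUnit (A * Aᵀ + Q)) :
    (φ.apply (stdCopy n)).Succeeds := by
  obtain ⟨e, hA, hb, hS, ho⟩ := h
  refine absCont_of_isUnit _ ?_
  have h1 : (marg (φ.apply (stdCopy n)).f).S = (A * Aᵀ + Q).submatrix e e := by
    rw [marg, wire_comp_S]
    ext k l
    exact apply_stdCopy_S_inr_inr_eq e hA hS k l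
  rw [h1]
  exact (Matrix.isUnit_submatrix_equiv e e).2 hu

/-- `G` is the regression matrix (Kalman gain) of the input on the observation. The observation has
prior mean `-c` and observed value `0`, hence the posterior mean `G c`. -/
theorem ObsHom.Models.exists_gain (h : φ.Models A (-c) Q)
    {κ : GaussHom (φ.apply (stdCopy n)).K (Fin n ⊕ Fin 0)}
    (hκ : IsConditional (φ.apply (stdCopy n)).f κ) :
    ∃ G : Matrix (Fin n) (Fin r) ℝ, G * (A * Aᵀ + Q) = Aᵀ ∧
      (∀ i, (κ.comp (φ.apply (stdCopy n)).obs).b (.inl i) = (G *ᵥ c) i) ∧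
      ∀ i j, (κ.comp (φ.apply (stdCopy n)).obs).S (.inl i) (.inl j) =
        (1 : Matrix (Fin n) (Fin n) ℝ) i j - (G * A) j i := by
  obtain ⟨e, hA, hb, hS, ho⟩ := h
  obtain ⟨h1, h2, h3⟩ := hκ.eqs
  let G : Matrix (Fin n) (Fin r) ℝ := Matrix.of fun i l => κ.A (.inl i) (e.symm l)
  have hG (i : Fin n) (k : φ.K) : G i (e k) = κ.A (.inl i) k :=
    congrArg (κ.A (.inl i)) (e.symm_apply_apply k)
  have hsum (F : Fin r → ℝ) (i : Fin n) :
      ∑ k : φ.K, G i (e k) * F (e k) = ∑ l, G i l * F l := e.sum_comp fun l => G i l * F l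
  have hobs : (φ.apply (stdCopy n)).obs.b = 0 := funext ho
  refine ⟨G, ?_, fun i => ?_, fun i j => ?_⟩
  · ext i l
    obtain ⟨l, rfl⟩ := e.surjective l
    rw [Matrix.mul_apply, ← hsum fun m => (A * Aᵀ + Q) m (e l)]
    refine Eq.trans ?_ ((h2 (.inl i) l).trans ((apply_stdCopy_S_inl_inr φ i l).trans (hA l i)))
    exact Finset.sum_congr rfl fun k _ =>
      congrArg₂ (· * ·) (hG i k) (apply_stdCopy_S_inr_inr_eq e hA hS k l).symm
  · have h4 : ∑ k : φ.K, G i (e k) * (-c) (e k) + κ.b (.inl i) = 0 := by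
      refine Eq.trans ?_ ((h1 (.inl i)).trans (apply_stdCopy_b_inl φ i))
      refine congrArg (· + κ.b (.inl i)) (Finset.sum_congr rfl fun k _ => ?_)
      exact congrArg₂ (· * ·) (hG i k) ((apply_stdCopy_b_inr φ k).trans (hb k)).symm
    rw [hsum] at h4
    simp only [Pi.neg_apply, mul_neg, Finset.sum_neg_distrib] at h4
    rw [comp_b, hobs, Matrix.mulVec_zero, zero_add, Matrix.mulVec, dotProduct]
    linarith
  · have h4 : ∑ k : φ.K, G j (e k) * A (e k) i + κ.S (.inl i) (.inl j) =
        (1 : Matrix (Fin n) (Fin n) ℝ) i j := by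
      refine Eq.trans ?_ ((h3 (.inl i) (.inl j)).trans (apply_stdCopy_S_inl_inl φ i j))
      refine congrArg (· + κ.S (.inl i) (.inl j)) (Finset.sum_congr rfl fun k _ => ?_)
      refine (mul_comm _ _).trans ?_
      exact congrArg₂ (· * ·) ((apply_stdCopy_S_inl_inr φ i k).trans (hA k i)).symm (hG j k)
    rw [hsum fun l => A l i] at h4
    rw [comp_S, show (φ.apply (stdCopy n)).obs.S = 0 from rfl, Matrix.mul_zero, Matrix.zero_mul,
      zero_add, Matrix.mul_apply]
    linarith

end Posterior

section Uniqueness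

variable {n r r' k k' : ℕ} {A : Matrix (Fin r) (Fin n) ℝ} {B : Matrix (Fin r) (Fin k) ℝ}
  {c : Fin r → ℝ} {A' : Matrix (Fin r') (Fin n) ℝ} {B' : Matrix (Fin r') (Fin k') ℝ}
  {c' : Fin r' → ℝ}

/-- A right inverse makes the rows of `A` independent, so `A Aᵀ` is positive definite, and adding `B
Bᵀ` keeps it so. -/
theorem isUnit_cov (hA : IsRREF A) (h0 : ∀ i, A i ≠ 0) : IsUnit (A * Aᵀ + B * Bᵀ) := by
  obtain ⟨R, hR⟩ := hA.exists_rightInverse h0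
  have h1 : (A * Aᵀ).PosDef := by
    rw [← Matrix.conjTranspose_eq_transpose_of_trivial]
    refine Matrix.PosDef.mul_conjTranspose_self A fun x y hxy => ?_
    have h2 := congrArg (· ᵥ* R) hxy
    simpa [Matrix.vecMul_vecMul, hR] using h2
  have h2 : (B * Bᵀ).PosSemidef := by
    rw [← Matrix.conjTranspose_eq_transpose_of_trivial]
    exact Matrix.posSemidef_self_mul_conjTranspose B
  exact (h1.add_posSemidef h2).isUnit

theorem not_condEq_bot (hA : IsRREF A) (h0 : ∀ i, A i ≠ 0) :
    ¬ ObsHom.CondEq (Tm.soft A B c).den (Tm.bot : Tm n 0).den := by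
  intro h
  have hs := (models_soft A B c).succeeds (isUnit_cov hA h0)
  have hb : ¬ ((Tm.bot : Tm n 0).den.apply (stdCopy n)).Succeeds := by
    -- The observed variable is the constant `1`, whereas the observation is `0`.
    refine not_absCont_of_ne (i := ()) ?_ ?_
    · rw [marg, wire_comp_S]
      ext k l
      refine (apply_stdCopy_S_inr_inr _ k l).trans ?_
      simp [Tm.den, det]
    · rw [marg, wire_comp_b]
      refine fun he => ?_
      have h1 := he.trans (apply_stdCopy_b_inr (Tm.bot : Tm n 0).den ())
      exact zero_ne_one h1
  rcases h n (stdCopy n) with ⟨-, h', -⟩ | ⟨h', -⟩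
  · exact hb h'
  · exact h' hs

/-- Transposing `A R = 1` shows that `Rᵀ G` inverts `S`; hence `A = S Rᵀ G A = S Rᵀ G' A'`. -/
theorem span_rows_le_of_gain {S : Matrix (Fin r) (Fin r) ℝ} {G : Matrix (Fin n) (Fin r) ℝ}
    {G' : Matrix (Fin n) (Fin r') ℝ} (hA : IsRREF A) (h0 : ∀ i, A i ≠ 0) (hG : G * S = Aᵀ)
    (h : G * A = G' * A') :
    Submodule.span ℝ (Set.range A) ≤ Submodule.span ℝ (Set.range A') := by
  obtain ⟨R, hR⟩ := hA.exists_rightInverse h0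
  have h1 : Rᵀ * G * S = 1 := by
    rw [Matrix.mul_assoc, hG, ← Matrix.transpose_mul, hR, Matrix.transpose_one]
  have h2 : A = S * Rᵀ * G' * A' := by
    rw [Matrix.mul_assoc _ G', ← h, Matrix.mul_assoc, ← Matrix.mul_assoc Rᵀ,
      ← Matrix.mul_assoc, mul_eq_one_comm.1 h1, Matrix.one_mul]
  rw [h2]
  exact span_rows_mul_le _ _

theorem sameData_of_condEq (hA : IsRREF A) (h0 : ∀ i, A i ≠ 0) (hA' : IsRREF A')
    (h0' : ∀ i, A' i ≠ 0) (h : ObsHom.CondEq (Tm.soft A B c).den (Tm.soft A' B' c').den) :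
    SameData A B c A' B' c' := by
  have hs := (models_soft A B c).succeeds (isUnit_cov hA h0)
  rcases h n (stdCopy n) with ⟨-, -, κ, κ', hκ, hκ', hp⟩ | ⟨h', -⟩
  swap
  · exact absurd hs h'
  obtain ⟨G, hG, hGb, hGS⟩ := (models_soft A B c).exists_gain hκ
  obtain ⟨G', hG', hGb', hGS'⟩ := (models_soft A' B' c').exists_gain hκ'
  have hb : G *ᵥ c = G' *ᵥ c' := by
    ext i
    rw [← hGb, ← hGb', hp]
  have hGA : G * A = G' * A' := by
    ext j i
    have h1 := hGS i j
    rw [hp, hGS', sub_right_inj] at h1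
    exact h1.symm
  obtain ⟨e, hAA⟩ := hA.eq_of_span_eq h0 hA' h0' (le_antisymm
    (span_rows_le_of_gain hA h0 hG hGA) (span_rows_le_of_gain hA' h0' hG' hGA.symm))
  subst e
  simp only [Fin.cast_refl, Matrix.submatrix_id_id] at hAA
  subst hAA
  obtain ⟨R, hR⟩ := hA.exists_rightInverse h0
  have hGG : G = G' := by
    have h1 := congrArg (· * R) hGA
    simpa [Matrix.mul_assoc, hR] using h1
  subst hGG
  have h1 : Rᵀ * G * (A * Aᵀ + B * Bᵀ) = 1 := by
    rw [Matrix.mul_assoc, hG, ← Matrix.transpose_mul, hR, Matrix.transpose_one]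
  have h2 : (A * Aᵀ + B * Bᵀ) * (Rᵀ * G) = 1 := mul_eq_one_comm.1 h1
  -- `G` has the left inverse `S Rᵀ`, so it can be cancelled, both from `G S = G S'` and from `G c =
  -- G c'`.
  have h3 {m : ℕ} {M N : Matrix (Fin r) (Fin m) ℝ} (hMN : G * M = G * N) : M = N := by
    rw [← Matrix.one_mul M, ← h2, Matrix.mul_assoc, Matrix.mul_assoc, hMN, ← Matrix.mul_assoc Rᵀ,
      ← Matrix.mul_assoc, h2, Matrix.one_mul]
  refine ⟨rfl, rfl, ?_, ?_⟩
  · have h4 := congrArg (fun v => (A * Aᵀ + B * Bᵀ) *ᵥ (Rᵀ *ᵥ v)) hb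
    simp only [Matrix.mulVec_mulVec, h2, Matrix.one_mulVec] at h4
    exact h4
  · exact add_left_cancel (h3 (hG.trans hG'.symm))

end Uniqueness

end ExactCond

theorem mainTheorem2 (n : ℕ) :
    -- every term of unit type has a normal form
    (∀ u : ExactCond.Tm n 0, ExactCond.Der u .bot ∨
      ∃ (r k : ℕ) (A : Matrix (Fin r) (Fin n) ℝ) (B : Matrix (Fin r) (Fin k) ℝ) (c : Fin r → ℝ),
        ExactCond.IsRREF A ∧ (∀ i, A i ≠ 0) ∧ ExactCond.Der u (.soft A B c)) ∧
    -- the two alternatives exclude each other, and the data are determined by the term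
    (∀ (u : ExactCond.Tm n 0) (r k : ℕ) (A : Matrix (Fin r) (Fin n) ℝ)
      (B : Matrix (Fin r) (Fin k) ℝ) (c : Fin r → ℝ),
      ExactCond.IsRREF A → (∀ i, A i ≠ 0) → ExactCond.Der u (.soft A B c) →
        ¬ ExactCond.Der u .bot ∧
        ∀ (r' k' : ℕ) (A' : Matrix (Fin r') (Fin n) ℝ) (B' : Matrix (Fin r') (Fin k') ℝ)
          (c' : Fin r' → ℝ), ExactCond.IsRREF A' → (∀ i, A' i ≠ 0) →
          ExactCond.Der u (.soft A' B' c') → ExactCond.SameData A B c A' B' c') ∧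
    -- indeed, already by the denotation in `Cond(Gauss)`
    (∀ (r k : ℕ) (A : Matrix (Fin r) (Fin n) ℝ) (B : Matrix (Fin r) (Fin k) ℝ) (c : Fin r → ℝ),
      ExactCond.IsRREF A → (∀ i, A i ≠ 0) →
        ¬ ExactCond.ObsHom.CondEq (ExactCond.Tm.soft A B c).den
          (ExactCond.Tm.bot : ExactCond.Tm n 0).den ∧
        ∀ (r' k' : ℕ) (A' : Matrix (Fin r') (Fin n) ℝ) (B' : Matrix (Fin r') (Fin k') ℝ)
          (c' : Fin r' → ℝ), ExactCond.IsRREF A' → (∀ i, A' i ≠ 0) →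
          ExactCond.ObsHom.CondEq (ExactCond.Tm.soft A B c).den
            (ExactCond.Tm.soft A' B' c').den →
          ExactCond.SameData A B c A' B' c') := by
  refine ⟨ExactCond.hasNormalForm, fun u r k A B c hA h0 hu => ⟨fun hb => ?_,
    fun r' k' A' B' c' hA' h0' hu' => ?_⟩, fun r k A B c hA h0 =>
      ⟨ExactCond.not_condEq_bot hA h0, fun r' k' A' B' c' hA' h0' h =>
        ExactCond.sameData_of_condEq hA h0 hA' h0' h⟩⟩
  · exact ExactCond.not_energyEq_bot hA h0 (hu.symm.trans hb).energyEq
  · exact ExactCond.sameData_of_energyEq hA h0 hA' h0' (hu.symm.trans hu').energyEq
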